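/- Let $\mathcal X$ be a Polish space with its Borel $\sigma$-algebra, let $I:\mathcal X\to[0,\infty]$ be a function that is continuous on its domain of finiteness $D=\{I<\infty\}$ (that is, $I|_D$ is continuous), and let $\gamma$ be a measure on $\mathcal X$. For $T\in(0,\infty]$ put $\mu^{T}(dx)=\frac1{Z^{T}}e^{-I(x)/T}\gamma(dx)$ with $Z^T=\int e^{-I/T}d\gamma$ (so $\mu^\infty=\gamma/\gamma(\mathcal X)$, which makes sense only if $0<\gamma(\mathcal X)<\infty$). Assume that $\mu^\varepsilon$ is a well-defined probability measure for every $\varepsilon\in(0,\infty)$ and that $\{\mu^\varepsilon\}$ satisfies the large deviation principle as $\varepsilon\downarrow0$ with scaling $\varepsilon$ and rate function $I$ (in particular, $I$ has compact sublevel sets). Let $A\subset\mathcal X$ be the closure of its interior, and suppose that $A\cap D$ is also the closure of its interior in the subspace $D$ (this is automatic if $D$ is open). Write $I(A)=\inf_{x\in A}I(x)\in[0,\infty]$. Let $K\ge1$, let $\Sigma_K$ be the set of permutations of $\{1,\dots,K\}$, and call $\boldsymbol\alpha=(\alpha_1,\dots,\alpha_K)$ admissible if $1=\alpha_1\ge\alpha_2\ge\cdots\ge\alpha_K\ge0$.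 For $\mathbf x\in\mathcal X^K$ and $\sigma\in\Sigma_K$ write $\mathbf x_\sigma=(x_{\sigma(1)},\dots,x_{\sigma(K)})$, and let $$\rho^\varepsilon(\mathbf x;\boldsymbol\alpha)=\frac{e^{-\frac1\varepsilon\sum_{j}\alpha_jI(x_j)}}{\sum_{\tau\in\Sigma_K}e^{-\frac1\varepsilon\sum_j\alpha_jI(x_{\tau(j)})}},\qquad \hat\theta^\varepsilon(\mathbf x;\boldsymbol\alpha)=\sum_{\sigma\in\Sigma_K}\rho^\varepsilon(\mathbf x_\sigma;\boldsymbol\alpha)\,1_A(x_{\sigma(1)}),$$ with the conventions $e^{-\infty}=0$, $0\cdot\infty=0$ and $0/0=0$. Then for every admissible $\boldsymbol\alpha$ and all $\mathbf X^\varepsilon=(X_1^\varepsilon,\dots,X_K^\varepsilon)$ with independent components $X_j^\varepsilon\sim\mu^{\varepsilon/\alpha_j}$ (where $\varepsilon/0=\infty$), $$\lim_{\varepsilon\to0}-\varepsilon\log E\big(\hat\theta^\varepsilon(\mathbf X^\varepsilon;\boldsymbol\alpha)\big)^2=V(\boldsymbol\alpha)\cdot I(A)\quad\text{in }[0,\infty],$$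 where $$V(\boldsymbol\alpha)=\inf\Big\{2\sum_{j=1}^K\alpha_jI_j-\min_{\sigma\in\Sigma_K}\sum_{j=1}^K\alpha_jI_{\sigma(j)}\;:\;I_1=1,\ I_j\in[0,1]\text{ for }j=2,\dots,K\Big\}.$$ Moreover, over all admissible $\boldsymbol\alpha$, $V(\boldsymbol\alpha)$ attains its maximal value, $2-(1/2)^{K-1}$, at $\boldsymbol\alpha^*=(1,1/2,\dots,1/2^{K-1})$. -/

import Mathlib

open Set Filter Topology MeasureTheory ProbabilityTheory
open scoped NNReal ENNReal

namespace INS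

noncomputable section

/-- `I(A)`, the infimum of `I` over `A` (equal to `∞` if `A` is empty). -/
def infOver {𝒳 : Type*} (I : 𝒳 → ℝ≥0∞) (A : Set 𝒳) : ℝ≥0∞ :=
  ⨅ x ∈ A, I x

/-- `I` is a rate function: every sublevel set at a finite level is compact. -/
def IsRateFunction {𝒳 : Type*} [TopologicalSpace 𝒳] (I : 𝒳 → ℝ≥0∞) : Prop :=
  ∀ M : ℝ≥0, IsCompact {x | I x ≤ M}

/-- The large deviation principle with scaling `ε` (as `ε ↓ 0`) and rate function `I`. -/
structure SatisfiesLDP {𝒳 : Type*} [TopologicalSpace 𝒳] [MeasurableSpace 𝒳]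
    (μ : ℝ → Measure 𝒳) (I : 𝒳 → ℝ≥0∞) : Prop where
  isRateFunction : IsRateFunction I
  lower_bound : ∀ G : Set 𝒳, IsOpen G →
    -(infOver I G : EReal) ≤
      liminf (fun ε : ℝ => (ε : EReal) * ENNReal.log (μ ε G)) (𝓝[>] (0 : ℝ))
  upper_bound : ∀ F : Set 𝒳, IsClosed F →
    limsup (fun ε : ℝ => (ε : EReal) * ENNReal.log (μ ε F)) (𝓝[>] (0 : ℝ)) ≤
      -(infOver I F : EReal)

/-- `e^{-t}` for `t ∈ [0, ∞]`, with `e^{-∞} = 0`. -/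
def expNeg (t : ℝ≥0∞) : ℝ≥0∞ := EReal.exp (-(t : EReal))

/-- The normalizing constant `∫ e^{-I/T} dγ` at temperature `T`. At `T = ∞` the integrand is `1`. -/
def partitionFunction {𝒳 : Type*} [MeasurableSpace 𝒳] (γ : Measure 𝒳) (I : 𝒳 → ℝ≥0∞)
    (T : ℝ≥0∞) : ℝ≥0∞ :=
  ∫⁻ x, expNeg (I x / T) ∂γ

/-- The measure `Z⁻¹ e^{-I/T} dγ` at temperature `T`. It is a probability measure exactly when the
normalizing constant `Z` lies in `(0, ∞)`, and it is the zero measure otherwise. -/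
def gibbs {𝒳 : Type*} [MeasurableSpace 𝒳] (γ : Measure 𝒳) (I : 𝒳 → ℝ≥0∞)
    (T : ℝ≥0∞) : Measure 𝒳 :=
  (partitionFunction γ I T)⁻¹ • γ.withDensity (fun x => expNeg (I x / T))

/-- The probability measures `μ^ε`, `ε ∈ (0, ∞)`, have the form `Z⁻¹ e^{-I/ε} dγ` and satisfy the
large deviation principle with rate function `I`. -/
structure IsGibbsFamily {𝒳 : Type*} [TopologicalSpace 𝒳] [MeasurableSpace 𝒳]
    (μ : ℝ → Measure 𝒳) (γ : Measure 𝒳) (I : 𝒳 → ℝ≥0∞) : Prop where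
  isProbabilityMeasure : ∀ ε : ℝ, 0 < ε → IsProbabilityMeasure (μ ε)
  eq_gibbs : ∀ ε : ℝ, 0 < ε → μ ε = gibbs γ I (ENNReal.ofReal ε)
  ldp : SatisfiesLDP μ I

/-- `1 = α₁ ≥ α₂ ≥ ⋯ ≥ α_K ≥ 0`. -/
def IsParameter {K : ℕ} [NeZero K] (α : Fin K → ℝ≥0) : Prop :=
  α 0 = 1 ∧ Antitone α

/-- The exponential weight `exp(-(1/ε) ∑ⱼ αⱼ I(xⱼ))`. -/
def expWeight {𝒳 : Type*} {K : ℕ} (I : 𝒳 → ℝ≥0∞) (α : Fin K → ℝ≥0) (ε : ℝ)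
    (x : Fin K → 𝒳) : ℝ≥0∞ :=
  expNeg ((∑ j, (α j : ℝ≥0∞) * I (x j)) / ENNReal.ofReal ε)

/-- The weights `ρ^ε(x; α)`. -/
def rho {𝒳 : Type*} {K : ℕ} (I : 𝒳 → ℝ≥0∞) (α : Fin K → ℝ≥0) (ε : ℝ)
    (x : Fin K → 𝒳) : ℝ≥0∞ :=
  expWeight I α ε x / ∑ τ : Equiv.Perm (Fin K), expWeight I α ε (fun j => x (τ j))

/-- The `K`-temperature INS estimator `θ̂^ε(x; α)` for `μ^ε(A)`. -/
def insEstimator {𝒳 : Type*} {K : ℕ} [NeZero K] (I : 𝒳 → ℝ≥0∞) (A : Set 𝒳)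
    (α : Fin K → ℝ≥0) (ε : ℝ) (x : Fin K → 𝒳) : ℝ≥0∞ :=
  ∑ σ : Equiv.Perm (Fin K),
    rho I α ε (fun j => x (σ j)) * A.indicator (fun _ => (1 : ℝ≥0∞)) (x (σ 0))

/-- `2 ∑ⱼ αⱼ Iⱼ - min_σ ∑ⱼ αⱼ I_{σ(j)}`. -/
def decayFunctional {K : ℕ} (α : Fin K → ℝ≥0) (v : Fin K → ℝ) : ℝ :=
  2 * ∑ j, (α j : ℝ) * v j -
    Finset.univ.inf' Finset.univ_nonempty
      (fun σ : Equiv.Perm (Fin K) => ∑ j, (α j : ℝ) * v (σ j))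

/-- `V(α)`: the infimum of the decay functional over `I₁ = 1`, `Iⱼ ∈ [0, 1]` for `j ≥ 2`. -/
def V {K : ℕ} [NeZero K] (α : Fin K → ℝ≥0) : ℝ :=
  sInf (decayFunctional α '' {v | v 0 = 1 ∧ ∀ j, j ≠ 0 → v j ∈ Icc (0 : ℝ) 1})

/-- `α* = (1, 1/2, …, 1/2^{K-1})`. -/
def alphaStar (K : ℕ) : Fin K → ℝ≥0 := fun j => (1 / 2) ^ (j : ℕ)

end

end INS

/-
By Abel summation against the rotation that moves the largest entry to the end, `V α` is the least
of the `K` numbers `2 + ∑_{j > k} αⱼ - α_k`. If they are all at least `c`, backward induction gives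
`α_k ≤ (2 - c) 2^{K-1} α*_k`, and `k = 0` yields `c ≤ 2 - (1/2)^{K-1}`; for `α*` they all have this
value.

The decay functional is homogeneous and additive on similarly ordered vectors, so it is at least
`V(α) v₁` on all of `[0, ∞)^K`, and `θ̂² · exp(-∑ⱼ αⱼ I(xⱼ)/ε) ≤ (K!)² exp(-V(α) I(A)/ε)`. Since
`θ̂ ≤ 1`, this inequality may be raised to the power `1 - ε`, and under the joint Gibbs law the
expectation of `exp((1 - ε) ∑ⱼ αⱼ I(xⱼ)/ε)` is a product of ratios of partition functions, hence of
size `exp(o(1)/ε)`. The matching lower bound comes from the event that the coordinates of index at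
least `k`, for a minimizing `k`, lie in `A` with energy near `I(A)` while the others have energy
near `0`. For both bounds it is the essential infimum of `I` over `A` that counts; the large
deviation lower bound forces `γ` to charge the relatively open subsets of `D`, so that it equals
`I(A)`.
-/

namespace INS

section Rearrangement

theorem sum_mul_le_sum_mul_of_monotone_comp {n : ℕ} {R : Type*} [Semiring R] [LinearOrder R]
    [IsStrictOrderedRing R] [ExistsAddOfLE R] {a v : Fin n → R} (ha : Antitone a)
    {τ : Equiv.Perm (Fin n)} (hτ : Monotone (v ∘ τ)) (σ : Equiv.Perm (Fin n)) :
    ∑ j, a j * v (τ j) ≤ ∑ j, a j * v (σ j) := by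
  simpa using (ha.antivary hτ).sum_mul_le_sum_mul_comp_perm (σ := σ.trans τ.symm)

theorem sum_Ici_finRotate {M : Type*} [AddCommMonoid M] {n : ℕ} (f : Fin (n + 1) → M)
    (k : Fin (n + 1)) :
    ∑ j ∈ Finset.Ici k, f (finRotate (n + 1) j) = f 0 + ∑ j ∈ Finset.Ioi k, f j := by
  have himage : (Finset.Ici k).map (finRotate (n + 1)).toEmbedding =
      Finset.cons 0 (Finset.Ioi k) (by simp) := by
    ext j
    rw [Finset.mem_map_equiv, Finset.mem_Ici, Finset.mem_cons, Finset.mem_Ioi]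
    refine Fin.cases ?_ (fun i => ?_) j
    · simp [(Equiv.symm_apply_eq _).2 finRotate_last.symm, Fin.le_last]
    · have hi : (finRotate (n + 1)).symm i.succ = i.castSucc :=
        (Equiv.symm_apply_eq _).2 (by simp)
      simp [hi, Fin.le_castSucc_iff, Fin.succ_ne_zero]
  rw [← Finset.sum_cons (f := f) (by simp), ← himage, Finset.sum_map]
  rfl

theorem mul_last_le_sum_mul {R : Type*} [CommRing R] [LinearOrder R] [IsStrictOrderedRing R]
    {n : ℕ} {u w : Fin (n + 1) → R} {c : R} (hw : Monotone w) (hw0 : 0 ≤ w 0)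
    (hu : ∀ k, c ≤ ∑ j ∈ Finset.Ici k, u j) :
    c * w (Fin.last n) ≤ ∑ j, u j * w j := by
  induction n with
  | zero => simpa using mul_le_mul_of_nonneg_right (hu 0) hw0
  | succ n ih =>
    have htail : c * (w (Fin.last (n + 1)) - w 0) ≤
        ∑ j : Fin (n + 1), u j.succ * (w j.succ - w 0) :=
      ih (u := fun j => u j.succ) (w := fun j => w j.succ - w 0)
        (fun i j hij => sub_le_sub_right (hw (Fin.succ_le_succ_iff.2 hij)) _)
        (sub_nonneg.2 (hw (Fin.zero_le _)))
        (fun k => (hu k.succ).trans_eq (Fin.sum_Ici_succ u k))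
    have htotal : c * w 0 ≤ (∑ j, u j) * w 0 := by
      refine mul_le_mul_of_nonneg_right ((hu 0).trans_eq ?_) hw0
      rw [← bot_eq_zero, Finset.Ici_bot]
    rw [Fin.sum_univ_succ] at htotal ⊢
    simp only [mul_sub, Finset.sum_sub_distrib, ← Finset.sum_mul] at htail
    linarith

end Rearrangement

section DecayFunctional

variable {K : ℕ} {α : Fin K → ℝ≥0} {v : Fin K → ℝ}

theorem antitone_coe (hα : Antitone α) : Antitone fun j => (α j : ℝ) :=
  NNReal.coe_mono.comp_antitone hα

theorem le_decayFunctional (α : Fin K → ℝ≥0) (v : Fin K → ℝ) (σ : Equiv.Perm (Fin K)) :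
    2 * ∑ j, (α j : ℝ) * v j - ∑ j, (α j : ℝ) * v (σ j) ≤ decayFunctional α v :=
  sub_le_sub_left (Finset.inf'_le (fun σ : Equiv.Perm (Fin K) => ∑ j, (α j : ℝ) * v (σ j))
    (Finset.mem_univ σ)) _

theorem decayFunctional_eq_of_monotone (hα : Antitone α) {τ : Equiv.Perm (Fin K)}
    (hτ : Monotone (v ∘ τ)) :
    decayFunctional α v = 2 * ∑ j, (α j : ℝ) * v j - ∑ j, (α j : ℝ) * v (τ j) :=
  le_antisymm
    (sub_le_sub_left (Finset.le_inf' _ _ fun σ _ =>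
      sum_mul_le_sum_mul_of_monotone_comp (antitone_coe hα) hτ σ) _)
    (le_decayFunctional α v τ)

theorem sum_mul_le_decayFunctional (α : Fin K → ℝ≥0) (v : Fin K → ℝ) :
    ∑ j, (α j : ℝ) * v j ≤ decayFunctional α v := by
  have h := le_decayFunctional α v 1
  simp only [Equiv.Perm.coe_one, id_eq] at h
  linarith

theorem sum_mul_nonneg (hv : ∀ j, 0 ≤ v j) : 0 ≤ ∑ j, (α j : ℝ) * v j :=
  Finset.sum_nonneg fun j _ => mul_nonneg (α j).2 (hv j)

theorem decayFunctional_nonneg (hv : ∀ j, 0 ≤ v j) : 0 ≤ decayFunctional α v :=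
  (sum_mul_nonneg hv).trans (sum_mul_le_decayFunctional α v)

/-- The value of the decay functional at the indicator of `{0} ∪ {j | k < j}`, for admissible `α`.
The infimum `V α` is the least of these `K` numbers. -/
def tailDecay (α : Fin K → ℝ≥0) (k : Fin K) : ℝ :=
  2 + ∑ j ∈ Finset.Ioi k, (α j : ℝ) - α k

variable [NeZero K]

theorem mem_Icc_of_constraint (h0 : v 0 = 1) (hv : ∀ j, j ≠ 0 → v j ∈ Icc (0 : ℝ) 1)
    (j : Fin K) : v j ∈ Icc (0 : ℝ) 1 := by
  rcases eq_or_ne j 0 with rfl | hj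
  · simp [h0]
  · exact hv j hj

theorem V_le_decayFunctional (h0 : v 0 = 1) (hv : ∀ j, v j ∈ Icc (0 : ℝ) 1) :
    V α ≤ decayFunctional α v := by
  refine csInf_le ⟨0, ?_⟩ ⟨v, ⟨h0, fun j _ => hv j⟩, rfl⟩
  rintro _ ⟨w, ⟨hw0, hw⟩, rfl⟩
  exact decayFunctional_nonneg fun j => (mem_Icc_of_constraint hw0 hw j).1

theorem le_V {c : ℝ} (h : ∀ v : Fin K → ℝ, v 0 = 1 → (∀ j, v j ∈ Icc (0 : ℝ) 1) →
    c ≤ decayFunctional α v) : c ≤ V α := by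
  refine le_csInf ⟨_, fun _ => 1, ⟨rfl, fun j _ => by simp⟩, rfl⟩ ?_
  rintro _ ⟨w, ⟨hw0, hw⟩, rfl⟩
  exact h w hw0 (mem_Icc_of_constraint hw0 hw)

theorem one_le_V (hα : IsParameter α) : 1 ≤ V α := by
  refine le_V fun v h0 hv => le_trans ?_ (sum_mul_le_decayFunctional α v)
  simpa [hα.1, h0] using Finset.single_le_sum (f := fun j => (α j : ℝ) * v j)
    (fun j _ => mul_nonneg (α j).2 (hv j).1) (Finset.mem_univ 0)

end DecayFunctional

section StepLevel

variable {K : ℕ} {α : Fin K → ℝ≥0}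

/-- The increasing step function with values `0` and `a` that jumps at `k`. Rotated so that its last
value comes first, and for `a = 1`, it is the vector at which the decay functional takes the value
`tailDecay α k`; unrotated, it gives the energies `I(xⱼ)` on the event that dominates the second
moment. -/
def stepLevel (k : Fin K) (a : ℝ≥0) (j : Fin K) : ℝ≥0 := if k ≤ j then a else 0

theorem monotone_stepLevel (k : Fin K) (a : ℝ≥0) : Monotone (stepLevel k a) := by
  intro i j hij
  simp only [stepLevel]
  split_ifs with hi hj
  exacts [le_rfl, absurd (hi.trans hij) hj, zero_le, le_rfl]

theorem sum_mul_stepLevel (α : Fin K → ℝ≥0) (k : Fin K) (a : ℝ≥0) :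
    ∑ j, α j * stepLevel k a j = (α k + ∑ j ∈ Finset.Ioi k, α j) * a := by
  simp only [stepLevel, mul_ite, mul_zero, ← Finset.sum_filter]
  rw [Finset.filter_le_eq_Ici, ← Finset.sum_mul, ← Finset.add_sum_Ioi_eq_sum_Ici]

theorem sum_mul_stepLevel_finRotate_symm {n : ℕ} {α : Fin (n + 1) → ℝ≥0} (hα : α 0 = 1)
    {k : Fin (n + 1)} (hk : α k ≤ 1) (a : ℝ≥0) :
    ∑ j, α j * stepLevel k a ((finRotate (n + 1)).symm j) =
      ∑ j, α j * stepLevel k a j + (1 - α k) * a := by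
  rw [sum_mul_stepLevel, ← add_mul, add_right_comm, add_tsub_cancel_of_le hk, ← hα,
    ← sum_Ici_finRotate, ← Equiv.sum_comp (finRotate (n + 1)), Finset.sum_mul,
    ← Finset.filter_le_eq_Ici, Finset.sum_filter]
  simp only [Equiv.symm_apply_apply, stepLevel, mul_ite, mul_zero]

theorem coe_two_mul_add_sum_mul_stepLevel {k : Fin K} (hk : α k ≤ 1) (a : ℝ≥0) :
    ((2 * ((1 - α k) * a) + ∑ j, α j * stepLevel k a j : ℝ≥0) : ℝ) = tailDecay α k * a := by
  rw [sum_mul_stepLevel, tailDecay]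
  push_cast [NNReal.coe_sub hk]
  ring

end StepLevel

section TailDecay

variable {n : ℕ} {α : Fin (n + 1) → ℝ≥0}

theorem sum_Ici_two_mul_finRotate_sub (hα : α 0 = 1) (k : Fin (n + 1)) :
    ∑ j ∈ Finset.Ici k, (2 * (α (finRotate (n + 1) j) : ℝ) - α j) = tailDecay α k := by
  rw [Finset.sum_sub_distrib, ← Finset.mul_sum, sum_Ici_finRotate fun j => (α j : ℝ),
    ← Finset.add_sum_Ioi_eq_sum_Ici, hα, tailDecay, NNReal.coe_one]
  ring

-- A permutation fixing `0` sorts the tail of `v`; a rotation then moves `v 0`, the largest entry,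
-- to the end.
theorem mul_le_decayFunctional (hα : IsParameter α) {c : ℝ} (hc : ∀ k, c ≤ tailDecay α k)
    {v : Fin (n + 1) → ℝ} (hv : ∀ j, v j ∈ Icc 0 (v 0)) :
    c * v 0 ≤ decayFunctional α v := by
  set τ := Tuple.sort (v ∘ Fin.succ)
  have hτ : Monotone ((v ∘ Fin.succ) ∘ τ) := Tuple.monotone_sort _
  set π : Equiv.Perm (Fin (n + 1)) := Equiv.Perm.decomposeFin.symm (0, τ)
  have hπ_zero : π 0 = 0 := by simp [π]
  have hπ_succ (i : Fin n) : π i.succ = (τ i).succ := by simp [π]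
  set ρ := finRotate (n + 1)
  set w : Fin (n + 1) → ℝ := fun j => v (π (ρ j))
  have hw_last : w (Fin.last n) = v 0 := by simp [w, ρ, hπ_zero]
  have hw_castSucc (i : Fin n) : w i.castSucc = v (τ i).succ := by simp [w, ρ, hπ_succ]
  have hw : Monotone w := by
    intro i j
    refine Fin.lastCases (fun _ => hw_last ▸ (hv _).2) (fun j => ?_) j
    refine Fin.lastCases (fun h => absurd h (by simp)) (fun i h => ?_) i
    rw [hw_castSucc, hw_castSucc]
    exact hτ (Fin.castSucc_le_castSucc_iff.1 h)
  have hrearrange : ∑ j, (α (ρ j) : ℝ) * w j ≤ ∑ j, (α j : ℝ) * v j := by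
    rw [Equiv.sum_comp ρ fun j => (α j : ℝ) * v (π j), Fin.sum_univ_succ, Fin.sum_univ_succ,
      hπ_zero]
    simp only [hπ_succ]
    exact add_le_add_right (sum_mul_le_sum_mul_of_monotone_comp
      ((antitone_coe hα.2).comp_monotone (Fin.strictMono_succ.monotone)) hτ 1) _
  calc c * v 0 = c * w (Fin.last n) := by rw [hw_last]
    _ ≤ ∑ j, (2 * (α (ρ j) : ℝ) - α j) * w j := mul_last_le_sum_mul hw (hv _).1
        fun k => (hc k).trans_eq (sum_Ici_two_mul_finRotate_sub hα.1 k).symm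
    _ = 2 * ∑ j, (α (ρ j) : ℝ) * w j - ∑ j, (α j : ℝ) * w j := by
        simp only [sub_mul, Finset.sum_sub_distrib, Finset.mul_sum, mul_assoc]
    _ ≤ 2 * ∑ j, (α j : ℝ) * v j - ∑ j, (α j : ℝ) * w j := by linarith
    _ ≤ decayFunctional α v := le_decayFunctional α v (ρ.trans π)

theorem V_le_tailDecay (hα : IsParameter α) (k : Fin (n + 1)) : V α ≤ tailDecay α k := by
  set ρ := finRotate (n + 1)
  set v : Fin (n + 1) → ℝ := fun j => stepLevel k 1 (ρ.symm j)
  have hαk : α k ≤ 1 := hα.1 ▸ hα.2 (Fin.zero_le k)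
  have hv0 : v 0 = 1 := by
    simp [v, stepLevel, (Equiv.symm_apply_eq ρ).2 finRotate_last.symm, Fin.le_last]
  have hv (j) : v j ∈ Icc 0 1 := by
    simp only [v, stepLevel]
    split_ifs <;> simp
  have hvρ (j) : v (ρ j) = stepLevel k 1 j := by simp [v]
  have hmono : Monotone (v ∘ ρ) := fun i j hij => by
    simpa only [Function.comp_apply, hvρ, NNReal.coe_le_coe] using monotone_stepLevel k 1 hij
  have hsum : ∑ j, (α j : ℝ) * v j = ∑ j, (α j : ℝ) * stepLevel k 1 j + (1 - α k : ℝ≥0) * 1 := by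
    simp only [v, ρ]
    exact_mod_cast sum_mul_stepLevel_finRotate_symm hα.1 hαk 1
  calc V α ≤ decayFunctional α v := V_le_decayFunctional hv0 hv
    _ = 2 * ∑ j, (α j : ℝ) * v j - ∑ j, (α j : ℝ) * stepLevel k 1 j := by
        simp only [decayFunctional_eq_of_monotone hα.2 hmono, hvρ]
    _ = (2 * ((1 - α k) * 1) + ∑ j, α j * stepLevel k 1 j : ℝ≥0) := by
        rw [hsum]
        push_cast
        ring
    _ = tailDecay α k := by rw [coe_two_mul_add_sum_mul_stepLevel hαk, NNReal.coe_one, mul_one]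

end TailDecay

section VFormula

variable {K : ℕ} [NeZero K] {α : Fin K → ℝ≥0}

theorem exists_V_eq_tailDecay (hα : IsParameter α) : ∃ k, V α = tailDecay α k := by
  obtain ⟨n, rfl⟩ := Nat.exists_eq_add_one_of_ne_zero (NeZero.ne K)
  obtain ⟨k, -, hk⟩ := Finset.exists_min_image Finset.univ (tailDecay α) Finset.univ_nonempty
  refine ⟨k, (V_le_tailDecay hα k).antisymm (le_V fun v h0 hv => ?_)⟩
  simpa [h0] using mul_le_decayFunctional hα (fun i => hk i (Finset.mem_univ i))
    (v := v) (by simpa [h0] using hv)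

theorem V_mul_le_decayFunctional (hα : IsParameter α) {v : Fin K → ℝ} (hv : ∀ j, 0 ≤ v j) :
    V α * v 0 ≤ decayFunctional α v := by
  obtain ⟨n, rfl⟩ := Nat.exists_eq_add_one_of_ne_zero (NeZero.ne K)
  set τ := Tuple.sort v
  have hτ : Monotone (v ∘ τ) := Tuple.monotone_sort v
  set b : Fin (n + 1) → ℝ := fun j => min (v j) (v 0)
  set d : Fin (n + 1) → ℝ := fun j => max (v j - v 0) 0
  have hsplit (j) : v j = b j + d j := by
    rcases le_total (v j) (v 0) with h | h <;> simp [b, d, h]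
  have hb : V α * b 0 ≤ decayFunctional α b :=
    mul_le_decayFunctional hα (V_le_tailDecay hα) fun j =>
      ⟨le_min (hv j) (hv 0), by simp [b]⟩
  have hd : 0 ≤ decayFunctional α d := decayFunctional_nonneg fun j => le_max_right _ _
  have hbτ : Monotone (b ∘ τ) := fun i j hij => min_le_min_right _ (hτ hij)
  have hdτ : Monotone (d ∘ τ) := fun i j hij => max_le_max_right _ (sub_le_sub_right (hτ hij) _)
  rw [decayFunctional_eq_of_monotone hα.2 hbτ] at hb
  rw [decayFunctional_eq_of_monotone hα.2 hdτ] at hd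
  rw [decayFunctional_eq_of_monotone hα.2 hτ]
  simp only [hsplit, mul_add, Finset.sum_add_distrib] at hb hd ⊢
  have : d 0 = 0 := by simp [d]
  rw [this]
  linarith

theorem ofReal_V_mul_add_le (hα : IsParameter α) {b : Fin K → ℝ≥0} {τ : Equiv.Perm (Fin K)}
    (hτ : Monotone (b ∘ τ)) :
    ENNReal.ofReal (V α) * b 0 + ∑ j, (α j : ℝ≥0∞) * b (τ j) ≤
      2 * ∑ j, (α j : ℝ≥0∞) * b j := by
  have hb : V α * b 0 ≤ decayFunctional α fun j => (b j : ℝ) :=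
    V_mul_le_decayFunctional hα fun j => (b j).2
  rw [decayFunctional_eq_of_monotone hα.2 (NNReal.coe_mono.comp hτ),
    ← Real.coe_toNNReal _ (zero_le_one.trans (one_le_V hα)), le_sub_iff_add_le] at hb
  rw [ENNReal.ofReal]
  exact_mod_cast hb

theorem exists_perm_V_mul_add_le (hα : IsParameter α) (a : Fin K → ℝ≥0∞) :
    ∃ τ : Equiv.Perm (Fin K), ENNReal.ofReal (V α) * a 0 + ∑ j, (α j : ℝ≥0∞) * a (τ j) ≤
      2 * ∑ j, (α j : ℝ≥0∞) * a j := by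
  have htrunc (j) : Tendsto (fun m : ℕ => min (a j) m) atTop (𝓝 (a j)) := by
    simpa using (tendsto_const_nhds (x := a j)).min ENNReal.tendsto_nat_nhds_top
  have hfin (m : ℕ) (j) : min (a j) m ≠ ⊤ := by simp
  have hlim := (ENNReal.Tendsto.const_mul (htrunc 0)
    (Or.inr (ENNReal.ofReal_ne_top (r := V α)))).add
      (tendsto_finsetSum Finset.univ fun j _ => ENNReal.Tendsto.const_mul
        (htrunc (Tuple.sort a j)) (Or.inr (ENNReal.coe_ne_top (r := α j))))
  refine ⟨Tuple.sort a, le_of_tendsto' hlim fun m => ?_⟩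
  have hsort : Monotone ((fun j => (min (a j) m).toNNReal) ∘ Tuple.sort a) := fun i j hij =>
    ENNReal.toNNReal_mono (hfin m _) (min_le_min_right _ (Tuple.monotone_sort a hij))
  have h := ofReal_V_mul_add_le hα hsort
  simp only [ENNReal.coe_toNNReal (hfin m _)] at h
  refine h.trans ?_
  gcongr
  exact min_le_left _ _

end VFormula

section Optimal

variable {K : ℕ}

theorem isParameter_alphaStar (K : ℕ) [NeZero K] : IsParameter (alphaStar K) :=
  ⟨by simp [alphaStar], fun _ _ hij =>
    pow_le_pow_of_le_one (by simp) (by simp) (Fin.le_def.1 hij)⟩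

theorem sum_Ioi_alphaStar (k : Fin K) :
    ∑ j ∈ Finset.Ioi k, (alphaStar K j : ℝ) = alphaStar K k - (1 / 2) ^ (K - 1) := by
  obtain ⟨n, rfl⟩ := Nat.exists_eq_add_one_of_ne_zero k.pos.ne'
  induction k using Fin.reverseInduction with
  | last =>
    rw [← Fin.top_eq_last, Finset.Ioi_top]
    simp [alphaStar]
  | cast i ih =>
    have hIoi : Finset.Ioi i.castSucc = Finset.Ici i.succ := by
      ext j
      simp [Fin.castSucc_lt_iff_succ_le]
    rw [hIoi, ← Finset.add_sum_Ioi_eq_sum_Ici, ih]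
    simp only [alphaStar, Fin.val_succ, Fin.val_castSucc, pow_succ]
    push_cast
    ring

theorem tailDecay_alphaStar (k : Fin K) : tailDecay (alphaStar K) k = 2 - (1 / 2) ^ (K - 1) := by
  rw [tailDecay, sum_Ioi_alphaStar]
  ring

theorem V_alphaStar (K : ℕ) [NeZero K] : V (alphaStar K) = 2 - (1 / 2) ^ (K - 1) := by
  obtain ⟨k, hk⟩ := exists_V_eq_tailDecay (isParameter_alphaStar K)
  rw [hk, tailDecay_alphaStar]

theorem le_mul_alphaStar_of_le_tailDecay {α : Fin K → ℝ≥0} {c : ℝ}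
    (hc : ∀ k, c ≤ tailDecay α k) (k : Fin K) :
    (α k : ℝ) ≤ (2 - c) * 2 ^ (K - 1) * alphaStar K k := by
  induction k using WellFoundedGT.induction with
  | ind k ih =>
    calc (α k : ℝ) ≤ (2 - c) + ∑ j ∈ Finset.Ioi k, (α j : ℝ) := by
          have := hc k
          rw [tailDecay] at this
          linarith
      _ ≤ (2 - c) + ∑ j ∈ Finset.Ioi k, (2 - c) * 2 ^ (K - 1) * alphaStar K j := by
          gcongr with j hj
          exact ih j (Finset.mem_Ioi.1 hj)
      _ = (2 - c) * 2 ^ (K - 1) * alphaStar K k := by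
          rw [← Finset.mul_sum, sum_Ioi_alphaStar, mul_sub, mul_assoc _ _ ((1 / 2 : ℝ) ^ _),
            ← mul_pow]
          norm_num

theorem V_le_of_isParameter [NeZero K] {α : Fin K → ℝ≥0} (hα : IsParameter α) :
    V α ≤ 2 - (1 / 2) ^ (K - 1) := by
  obtain ⟨n, rfl⟩ := Nat.exists_eq_add_one_of_ne_zero (NeZero.ne K)
  have h := le_mul_alphaStar_of_le_tailDecay (V_le_tailDecay hα) 0
  rw [hα.1, (isParameter_alphaStar _).1, NNReal.coe_one, mul_one] at h
  rw [one_div, inv_pow, le_sub_comm]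
  exact (inv_le_iff_one_le_mul₀ (by positivity)).2 h

end Optimal

section ExpNeg

theorem expNeg_add (a b : ℝ≥0∞) : expNeg (a + b) = expNeg a * expNeg b := by
  rw [expNeg, expNeg, expNeg, ← EReal.exp_add, EReal.coe_ennreal_add,
    EReal.neg_add (Or.inl (by simp)) (Or.inr (by simp)), sub_eq_add_neg]

@[simp] theorem expNeg_zero : expNeg 0 = 1 := by simp [expNeg]

@[simp] theorem expNeg_top : expNeg ⊤ = 0 := by simp [expNeg]

theorem expNeg_antitone : Antitone expNeg := fun _ _ h =>
  EReal.exp_monotone (EReal.neg_le_neg_iff.2 (EReal.coe_ennreal_le_coe_ennreal_iff.2 h))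

theorem expNeg_le_one (a : ℝ≥0∞) : expNeg a ≤ 1 :=
  expNeg_zero ▸ expNeg_antitone zero_le

theorem expNeg_ne_top (a : ℝ≥0∞) : expNeg a ≠ ⊤ :=
  ne_top_of_le_ne_top ENNReal.one_ne_top (expNeg_le_one a)

theorem expNeg_ne_zero {a : ℝ≥0∞} (ha : a ≠ ⊤) : expNeg a ≠ 0 := by
  simpa [expNeg] using ha

theorem expNeg_sum {ι : Type*} (s : Finset ι) (f : ι → ℝ≥0∞) :
    expNeg (∑ i ∈ s, f i) = ∏ i ∈ s, expNeg (f i) := by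
  classical
  induction s using Finset.induction_on with
  | empty => simp
  | insert i s hi ih => rw [Finset.sum_insert hi, Finset.prod_insert hi, expNeg_add, ih]

theorem expNeg_rpow {η : ℝ} (hη : 0 ≤ η) (a : ℝ≥0∞) :
    expNeg a ^ η = expNeg (ENNReal.ofReal η * a) := by
  rw [expNeg, expNeg, ← EReal.exp_mul, EReal.coe_ennreal_mul, EReal.coe_ennreal_ofReal,
    max_eq_left hη, EReal.neg_mul, mul_comm]

theorem expNeg_rpow_sub_one_mul {η : ℝ} (hη : 0 < η) (a : ℝ≥0∞) :
    expNeg a ^ (η - 1) * expNeg a = expNeg (ENNReal.ofReal η * a) := by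
  rw [← expNeg_rpow hη.le]
  rcases eq_or_ne (expNeg a) 0 with h | h
  · rw [h, mul_zero, ENNReal.zero_rpow_of_pos hη]
  · rw [ENNReal.rpow_sub _ _ h (expNeg_ne_top a), ENNReal.rpow_one,
      ENNReal.div_mul_cancel h (expNeg_ne_top a)]

theorem measurable_expNeg : Measurable expNeg :=
  EReal.measurable_exp.comp measurable_coe_ennreal_ereal.neg

end ExpNeg

section Rate

theorem neg_mul_log_mul_expNeg {c r : ℝ≥0} (hc : c ≠ 0) {ε : ℝ} (hε : 0 < ε) :
    -((ε : EReal) * ENNReal.log (c * expNeg (r / ENNReal.ofReal ε))) =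
      ((r - ε * Real.log c : ℝ) : EReal) := by
  have hdiv : ((r / ENNReal.ofReal ε : ℝ≥0∞) : EReal) = ((r / ε : ℝ) : EReal) := by
    rw [← ENNReal.ofReal_coe_nnreal, ← ENNReal.ofReal_div_of_pos hε, EReal.coe_ennreal_ofReal,
      max_eq_left (by positivity)]
  rw [ENNReal.log_mul_add, ENNReal.log_pos_real (by simpa using hc) ENNReal.coe_ne_top, expNeg,
    EReal.log_exp, hdiv, ENNReal.coe_toReal]
  norm_cast
  field_simp
  ring

theorem tendsto_neg_mul_log_mul_expNeg {c : ℝ≥0} (hc : c ≠ 0) (r : ℝ≥0) :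
    Tendsto (fun ε : ℝ => -((ε : EReal) * ENNReal.log (c * expNeg (r / ENNReal.ofReal ε))))
      (𝓝[>] 0) (𝓝 ((r : ℝ≥0∞) : EReal)) := by
  have hreal : Tendsto (fun ε : ℝ => (r - ε * Real.log c : ℝ)) (𝓝[>] 0) (𝓝 (r : ℝ)) := by
    have hcont : Continuous fun ε : ℝ => (r - ε * Real.log c : ℝ) := by fun_prop
    simpa using (hcont.tendsto 0).mono_left nhdsWithin_le_nhds
  refine ((continuous_coe_real_ereal.tendsto _).comp hreal).congr' ?_
  filter_upwards [self_mem_nhdsWithin] with ε hε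
  exact (neg_mul_log_mul_expNeg hc hε).symm

theorem neg_mul_log_antitone {ε : ℝ} (hε : 0 < ε) :
    Antitone fun a : ℝ≥0∞ => -((ε : EReal) * ENNReal.log a) := fun _ _ h =>
  EReal.neg_le_neg_iff.2 (mul_le_mul_of_nonneg_left (ENNReal.log_monotone h)
    (EReal.coe_nonneg.2 hε.le))

theorem tendsto_neg_mul_log {E : ℝ → ℝ≥0∞} {L : ℝ≥0∞} (hE : ∀ᶠ ε in 𝓝[>] 0, E ε ≤ 1)
    (hupper : ∀ r : ℝ≥0, r < L → ∃ c : ℝ≥0∞, c ≠ ⊤ ∧ ∀ᶠ ε in 𝓝[>] 0,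
      E ε ≤ c * expNeg (r / ENNReal.ofReal ε))
    (hlower : ∀ r : ℝ≥0, L < r → ∃ c : ℝ≥0∞, c ≠ 0 ∧ ∀ᶠ ε in 𝓝[>] 0,
      c * expNeg (r / ENNReal.ofReal ε) ≤ E ε) :
    Tendsto (fun ε : ℝ => -((ε : EReal) * ENNReal.log (E ε))) (𝓝[>] 0) (𝓝 (L : EReal)) := by
  refine tendsto_order.2 ⟨fun a ha => ?_, fun a ha => ?_⟩
  · rcases lt_or_ge a 0 with ha0 | ha0
    · filter_upwards [hE, self_mem_nhdsWithin] with ε hε hpos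
      exact ha0.trans_le (by simpa using neg_mul_log_antitone hpos hε)
    lift a to ℝ≥0∞ using ha0
    obtain ⟨r, har, hrL⟩ := ENNReal.lt_iff_exists_nnreal_btwn.1
      (EReal.coe_ennreal_lt_coe_ennreal_iff.1 ha)
    obtain ⟨c, hc_top, hc⟩ := hupper r hrL
    lift c to ℝ≥0 using hc_top
    filter_upwards [hc, self_mem_nhdsWithin, (tendsto_neg_mul_log_mul_expNeg
      (c := c + 1) (by simp) r).eventually_const_lt (EReal.coe_ennreal_lt_coe_ennreal_iff.2 har)]
      with ε hε hpos hlt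
    refine hlt.trans_le (neg_mul_log_antitone hpos (hε.trans ?_))
    gcongr
    exact le_self_add
  · lift a to ℝ≥0∞ using (EReal.coe_ennreal_nonneg L).trans ha.le
    obtain ⟨r, hLr, hra⟩ := ENNReal.lt_iff_exists_nnreal_btwn.1
      (EReal.coe_ennreal_lt_coe_ennreal_iff.1 ha)
    obtain ⟨c, hc0, hc⟩ := hlower r hLr
    obtain ⟨b, hb0, hbc⟩ := ENNReal.lt_iff_exists_nnreal_btwn.1 hc0.bot_lt
    filter_upwards [hc, self_mem_nhdsWithin, (tendsto_neg_mul_log_mul_expNeg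
      (ENNReal.coe_pos.1 hb0).ne' r).eventually_lt_const
      (EReal.coe_ennreal_lt_coe_ennreal_iff.2 hra)] with ε hε hpos hlt
    refine (neg_mul_log_antitone hpos (le_trans ?_ hε)).trans_lt hlt
    gcongr

end Rate

section Gibbs

theorem div_temperature {ε : ℝ} (hε : 0 < ε) (α : ℝ≥0) (x : ℝ≥0∞) :
    x / (ENNReal.ofReal ε / α) = α * x / ENNReal.ofReal ε := by
  rw [div_eq_mul_inv, ENNReal.inv_div (Or.inl ENNReal.coe_ne_top) (Or.inr (by simpa using hε)),
    mul_comm, ENNReal.mul_div_right_comm]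

theorem ofReal_mul_div_eq_div_div {ε : ℝ} (hε : 0 < ε) (x T : ℝ≥0∞) :
    ENNReal.ofReal ε * (x / T) = x / (T / ENNReal.ofReal ε) := by
  rw [div_eq_mul_inv x (T / _), ENNReal.inv_div (Or.inl ENNReal.ofReal_ne_top)
    (Or.inl (by simpa using hε)), mul_comm, ENNReal.mul_comm_div]

theorem ofReal_div_div_ofReal {ε : ℝ} (hε : 0 < ε) (a : ℝ≥0∞) :
    ENNReal.ofReal ε / a / ENNReal.ofReal ε = ENNReal.ofReal 1 / a := by
  rw [ENNReal.div_right_comm, ENNReal.div_self (by simpa using hε) ENNReal.ofReal_ne_top,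
    ENNReal.ofReal_one]

variable {𝒳 : Type*} [MeasurableSpace 𝒳] {γ : Measure 𝒳} {I : 𝒳 → ℝ≥0∞}

theorem gibbs_apply (γ : Measure 𝒳) (I : 𝒳 → ℝ≥0∞) (T : ℝ≥0∞) {B : Set 𝒳}
    (hB : MeasurableSet B) :
    gibbs γ I T B = (partitionFunction γ I T)⁻¹ * ∫⁻ x in B, expNeg (I x / T) ∂γ := by
  simp [gibbs, withDensity_apply _ hB]

theorem gibbs_apply_eq_zero {T : ℝ≥0∞} (hT : T ≠ ⊤) {B : Set 𝒳} (hB : MeasurableSet B)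
    (hnull : γ (B ∩ {x | I x < ∞}) = 0) : gibbs γ I T B = 0 := by
  rw [gibbs_apply _ _ _ hB, mul_eq_zero]
  refine Or.inr (lintegral_eq_zero_of_ae_eq_zero ((ae_restrict_iff' hB).2 ?_))
  filter_upwards [measure_eq_zero_iff_ae_notMem.1 hnull] with x hx hxB
  have htop : I x = ⊤ := not_lt_top_iff.1 fun h => hx ⟨hxB, h⟩
  simp [htop, ENNReal.top_div_of_ne_top hT]

theorem gibbs_absolutelyContinuous (γ : Measure 𝒳) (I : 𝒳 → ℝ≥0∞) (T : ℝ≥0∞) :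
    gibbs γ I T ≪ γ :=
  (withDensity_absolutelyContinuous γ _).smul_left _

theorem partitionFunction_ne_zero_and_ne_top {T : ℝ≥0∞} [h : IsProbabilityMeasure (gibbs γ I T)] :
    partitionFunction γ I T ≠ 0 ∧ partitionFunction γ I T ≠ ⊤ := by
  have huniv := h.measure_univ
  rw [gibbs_apply _ _ _ .univ, Measure.restrict_univ, ← partitionFunction] at huniv
  constructor <;> intro hZ <;> simp [hZ] at huniv

theorem partitionFunction_mono (γ : Measure 𝒳) (I : 𝒳 → ℝ≥0∞) :
    Monotone (partitionFunction γ I) := fun _ _ hT =>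
  lintegral_mono fun _ => expNeg_antitone (ENNReal.div_le_div_left hT _)

theorem expNeg_mul_le_setLIntegral (γ : Measure 𝒳) (T : ℝ≥0∞) {B : Set 𝒳} (hB : MeasurableSet B)
    {b : ℝ≥0∞} (hb : ∀ x ∈ B, I x ≤ b) :
    expNeg (b / T) * γ B ≤ ∫⁻ x in B, expNeg (I x / T) ∂γ := by
  rw [← setLIntegral_const]
  exact setLIntegral_mono' hB fun x hx => expNeg_antitone (ENNReal.div_le_div_right (hb x hx) _)

theorem expNeg_mul_le_partitionFunction (hI : Measurable I) (T b : ℝ≥0∞) :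
    expNeg (b / T) * γ {x | I x ≤ b} ≤ partitionFunction γ I T :=
  (expNeg_mul_le_setLIntegral γ T (hI measurableSet_Iic) fun _ hx => hx).trans
    (setLIntegral_le_lintegral _ _)

theorem inv_mul_expNeg_le_gibbs {T T' : ℝ≥0∞} (hT : T ≤ T') {B : Set 𝒳} (hB : MeasurableSet B)
    {b : ℝ≥0∞} (hb : ∀ x ∈ B, I x ≤ b) :
    (partitionFunction γ I T')⁻¹ * (expNeg (b / T) * γ B) ≤ gibbs γ I T B := by
  rw [gibbs_apply _ _ _ hB]
  gcongr
  · exact partitionFunction_mono γ I hT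
  · exact expNeg_mul_le_setLIntegral γ T hB hb

theorem lintegral_expNeg_rpow_gibbs (hI : Measurable I) (T : ℝ≥0∞) {η : ℝ} (hη : 0 < η) :
    ∫⁻ x, expNeg (I x / T) ^ (η - 1) ∂gibbs γ I T =
      (partitionFunction γ I T)⁻¹ * partitionFunction γ I (T / ENNReal.ofReal η) := by
  have hm : Measurable fun x => expNeg (I x / T) := measurable_expNeg.comp (hI.div_const T)
  rw [gibbs, lintegral_smul_measure, smul_eq_mul,
    lintegral_withDensity_eq_lintegral_mul _ hm (hm.pow_const _)]
  congr 1
  refine lintegral_congr fun x => ?_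
  rw [Pi.mul_apply, mul_comm, expNeg_rpow_sub_one_mul hη, ofReal_mul_div_eq_div_div hη]

end Gibbs

section EssInf

theorem measure_preimage_Icc_essInf_ne_zero {𝒳 β : Type*} [MeasurableSpace 𝒳] {ν : Measure 𝒳}
    [CompleteLinearOrder β] [TopologicalSpace β] [FirstCountableTopology β] [OrderTopology β]
    {f : 𝒳 → β} {b : β} (hb : essInf f ν < b) : ν (f ⁻¹' Icc (essInf f ν) b) ≠ 0 := by
  intro hnull
  refine hb.not_ge (le_essInf_of_ae_le b ?_)
  filter_upwards [ae_essInf_le (f := f) (μ := ν), measure_eq_zero_iff_ae_notMem.1 hnull]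
    with x hx hxb
  exact (not_le.1 fun h => hxb ⟨hx, h⟩).le

end EssInf

section GibbsFamily

variable {𝒳 : Type*} [TopologicalSpace 𝒳] [MeasurableSpace 𝒳]
  {μ : ℝ → Measure 𝒳} {γ : Measure 𝒳} {I : 𝒳 → ℝ≥0∞}

theorem IsGibbsFamily.infOver_univ (hμ : IsGibbsFamily μ γ I) : infOver I univ = 0 := by
  have hle := hμ.ldp.upper_bound univ isClosed_univ
  have hzero : (fun ε : ℝ => (ε : EReal) * ENNReal.log (μ ε univ)) =ᶠ[𝓝[>] 0] fun _ => 0 := by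
    filter_upwards [self_mem_nhdsWithin] with ε hε
    have := hμ.isProbabilityMeasure ε hε
    rw [measure_univ, ENNReal.log_one, mul_zero]
  rw [limsup_congr hzero, limsup_const, EReal.le_neg, neg_zero] at hle
  exact le_antisymm (by exact_mod_cast hle) zero_le

variable [BorelSpace 𝒳]

theorem IsRateFunction.measurable [T2Space 𝒳] (h : IsRateFunction I) : Measurable I := by
  refine measurable_of_Iic fun a => ?_
  rcases eq_or_ne a ⊤ with rfl | ha
  · simp
  · lift a to ℝ≥0 using ha
    exact (h a).isClosed.measurableSet

theorem IsGibbsFamily.measure_inter_ne_zero (hμ : IsGibbsFamily μ γ I) {G : Set 𝒳}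
    (hG : IsOpen G) {x : 𝒳} (hx : x ∈ G) (hIx : I x < ∞) : γ (G ∩ {x | I x < ∞}) ≠ 0 := by
  intro hnull
  have hbot : (fun ε : ℝ => (ε : EReal) * ENNReal.log (μ ε G)) =ᶠ[𝓝[>] 0] fun _ => ⊥ := by
    filter_upwards [self_mem_nhdsWithin] with ε hε
    rw [hμ.eq_gibbs ε hε, gibbs_apply_eq_zero ENNReal.ofReal_ne_top hG.measurableSet hnull,
      ENNReal.log_zero, EReal.coe_mul_bot_of_pos hε]
  have hle := hμ.ldp.lower_bound G hG
  rw [liminf_congr hbot, liminf_const, le_bot_iff, EReal.neg_eq_bot_iff,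
    EReal.coe_ennreal_eq_top_iff] at hle
  exact hIx.not_ge (hle ▸ iInf₂_le x hx)

theorem IsGibbsFamily.measure_inter_lt_ne_zero (hμ : IsGibbsFamily μ γ I)
    (hI : ContinuousOn I {x | I x < ∞}) {A : Set 𝒳}
    (hAI : (Subtype.val ⁻¹' A : Set {x : 𝒳 // I x < ∞}) ⊆
      closure (interior (Subtype.val ⁻¹' A : Set {x : 𝒳 // I x < ∞})))
    {b : ℝ≥0∞} (hb : infOver I A < b) : γ (I ⁻¹' Iio b ∩ A) ≠ 0 := by
  obtain ⟨x, hxA, hxb⟩ : ∃ x ∈ A, I x < b := by simpa [infOver, iInf_lt_iff] using hb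
  have hopen : IsOpen {y : {x : 𝒳 // I x < ∞} | I y < b} :=
    isOpen_lt hI.domRestrict continuous_const
  obtain ⟨y, hyb, hyA⟩ := mem_closure_iff.1 (@hAI ⟨x, hxb.trans_le le_top⟩ hxA) _ hopen hxb
  obtain ⟨G, hG, hG_eq⟩ := isOpen_induced_iff.1 (hopen.inter isOpen_interior)
  refine fun hnull => hμ.measure_inter_ne_zero hG (hG_eq.ge ⟨hyb, hyA⟩) y.2
    (measure_mono_null ?_ hnull)
  rintro z ⟨hzG, hz⟩
  have hzG' : (⟨z, hz⟩ : {x : 𝒳 // I x < ∞}) ∈ Subtype.val ⁻¹' G := hzG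
  rw [hG_eq] at hzG'
  exact ⟨hzG'.1, (interior_subset hzG'.2 : (⟨z, hz⟩ : {x : 𝒳 // I x < ∞}) ∈ Subtype.val ⁻¹' A)⟩

theorem IsGibbsFamily.essInf_restrict_eq_infOver [T2Space 𝒳] (hμ : IsGibbsFamily μ γ I)
    (hI : ContinuousOn I {x | I x < ∞}) {A : Set 𝒳} (hA : MeasurableSet A)
    (hAI : (Subtype.val ⁻¹' A : Set {x : 𝒳 // I x < ∞}) ⊆
      closure (interior (Subtype.val ⁻¹' A : Set {x : 𝒳 // I x < ∞}))) :
    essInf I (γ.restrict A) = infOver I A := by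
  refine le_antisymm (le_of_forall_gt fun b hb => ?_) (le_essInf_of_ae_le _ ?_)
  · by_contra! hlt
    refine hμ.measure_inter_lt_ne_zero hI hAI hb ?_
    rw [← Measure.restrict_apply' hA, measure_eq_zero_iff_ae_notMem]
    filter_upwards [ae_essInf_le (f := I) (μ := γ.restrict A)] with x hx hxb
    exact (hlt.trans hx).not_gt hxb
  · filter_upwards [ae_restrict_mem hA] with x hx
    exact iInf₂_le x hx

theorem IsGibbsFamily.essInf_eq_zero [T2Space 𝒳] (hμ : IsGibbsFamily μ γ I)
    (hI : ContinuousOn I {x | I x < ∞}) : essInf I γ = 0 := by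
  simpa [hμ.infOver_univ] using hμ.essInf_restrict_eq_infOver hI .univ (by simp)

end GibbsFamily

section Estimator

variable {𝒳 : Type*} {K : ℕ} {I : 𝒳 → ℝ≥0∞} {A : Set 𝒳} {α : Fin K → ℝ≥0} {ε : ℝ}

theorem expWeight_eq_prod (x : Fin K → 𝒳) :
    expWeight I α ε x = ∏ j, expNeg (α j * I (x j) / ENNReal.ofReal ε) := by
  simp only [expWeight, ENNReal.div_eq_inv_mul, Finset.mul_sum, expNeg_sum]

theorem expWeight_le_sum (x : Fin K → 𝒳) (τ : Equiv.Perm (Fin K)) :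
    expWeight I α ε (fun j => x (τ j)) ≤
      ∑ σ : Equiv.Perm (Fin K), expWeight I α ε (fun j => x (σ j)) :=
  Finset.single_le_sum (f := fun σ : Equiv.Perm (Fin K) => expWeight I α ε (fun j => x (σ j)))
    (fun _ _ => zero_le) (Finset.mem_univ τ)

theorem sum_expWeight_ne_top (x : Fin K → 𝒳) :
    ∑ σ : Equiv.Perm (Fin K), expWeight I α ε (fun j => x (σ j)) ≠ ⊤ :=
  ENNReal.sum_ne_top.2 fun _ _ => expNeg_ne_top _

theorem rho_comp (x : Fin K → 𝒳) (σ : Equiv.Perm (Fin K)) :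
    rho I α ε (fun j => x (σ j)) = expWeight I α ε (fun j => x (σ j)) /
      ∑ τ : Equiv.Perm (Fin K), expWeight I α ε (fun j => x (τ j)) := by
  rw [rho]
  congr 1
  exact Fintype.sum_equiv (Equiv.mulLeft σ) _ _ fun τ => rfl

variable [NeZero K]

theorem insEstimator_le_one (x : Fin K → 𝒳) : insEstimator I A α ε x ≤ 1 := by
  calc insEstimator I A α ε x ≤ ∑ σ : Equiv.Perm (Fin K), rho I α ε (fun j => x (σ j)) * 1 := by
        refine Finset.sum_le_sum fun σ _ => ?_
        gcongr
        exact indicator_le_self' (fun _ _ => zero_le) _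
    _ ≤ 1 := by
        simp only [rho_comp, mul_one, ENNReal.div_eq_inv_mul, ← Finset.mul_sum]
        exact ENNReal.inv_mul_le_one _

theorem rho_sq_mul_expWeight_le (hα : IsParameter α) {ℓ : ℝ≥0∞} (x : Fin K → 𝒳)
    (σ : Equiv.Perm (Fin K)) (hx : ℓ ≤ I (x (σ 0))) :
    rho I α ε (fun j => x (σ j)) ^ 2 * expWeight I α ε x ≤
      expNeg (ENNReal.ofReal (V α) * ℓ / ENNReal.ofReal ε) := by
  set S := ∑ τ : Equiv.Perm (Fin K), expWeight I α ε (fun j => x (τ j))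
  set W := expWeight I α ε (fun j => x (σ j)) with hW
  set B := expNeg (ENNReal.ofReal (V α) * ℓ / ENNReal.ofReal ε)
  have hxS : expWeight I α ε x ≤ S := expWeight_le_sum x 1
  have hWS : W * W ≤ B * S := by
    obtain ⟨τ, hτ⟩ := exists_perm_V_mul_add_le hα fun j => I (x (σ j))
    calc W * W = expNeg ((2 * ∑ j, (α j : ℝ≥0∞) * I (x (σ j))) / ENNReal.ofReal ε) := by
          rw [hW, expWeight, ← expNeg_add, ← ENNReal.add_div, two_mul]
      _ ≤ expNeg ((ENNReal.ofReal (V α) * ℓ +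
            ∑ j, (α j : ℝ≥0∞) * I (x (σ (τ j)))) / ENNReal.ofReal ε) := by
          refine expNeg_antitone (ENNReal.div_le_div_right (le_trans ?_ hτ) _)
          gcongr
      _ = B * expWeight I α ε (fun j => x (σ (τ j))) := by
          rw [ENNReal.add_div, expNeg_add, expWeight]
      _ ≤ B * S := by
          gcongr
          exact expWeight_le_sum x (σ * τ)
  rw [rho_comp]
  rcases eq_or_ne S 0 with hS | hS
  · rw [hS, nonpos_iff_eq_zero] at hxS
    simp [hxS]
  calc (W / S) ^ 2 * expWeight I α ε x ≤ (W / S) ^ 2 * S := by gcongr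
    _ = W * W / S := by
        rw [sq, mul_assoc, ENNReal.div_mul_cancel hS (sum_expWeight_ne_top x), mul_comm,
          mul_div_assoc]
    _ ≤ B := ENNReal.div_le_of_le_mul hWS

theorem insEstimator_sq_mul_expWeight_le (hα : IsParameter α) {ℓ : ℝ≥0∞} {x : Fin K → 𝒳}
    (hx : ∀ j, x j ∈ A → ℓ ≤ I (x j)) :
    insEstimator I A α ε x ^ 2 * expWeight I α ε x ≤
      (K.factorial : ℝ≥0∞) ^ 2 * expNeg (ENNReal.ofReal (V α) * ℓ / ENNReal.ofReal ε) := by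
  set q : Equiv.Perm (Fin K) → ℝ≥0∞ := fun σ =>
    rho I α ε (fun j => x (σ j)) * A.indicator (fun _ => (1 : ℝ≥0∞)) (x (σ 0)) with hq
  obtain ⟨σ, -, hσ⟩ := Finset.exists_max_image Finset.univ q Finset.univ_nonempty
  have hsum : insEstimator I A α ε x ≤ K.factorial * q σ := by
    have hcard := Finset.sum_le_card_nsmul Finset.univ q (q σ) hσ
    rwa [Finset.card_univ, Fintype.card_perm, Fintype.card_fin, nsmul_eq_mul] at hcard
  calc insEstimator I A α ε x ^ 2 * expWeight I α ε x
      ≤ (K.factorial * q σ) ^ 2 * expWeight I α ε x := by gcongr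
    _ = (K.factorial : ℝ≥0∞) ^ 2 * (q σ ^ 2 * expWeight I α ε x) := by rw [mul_pow, mul_assoc]
    _ ≤ _ := by
        gcongr
        by_cases hxσ : x (σ 0) ∈ A
        · simpa [hq, hxσ] using rho_sq_mul_expWeight_le hα x σ (hx _ hxσ)
        · simp [hq, hxσ]

-- Since the estimator is at most `1`, the bound may be raised to a power `κ < 1`, which makes the
-- inverse weight integrable against the Gibbs measures.
theorem insEstimator_sq_le (hα : IsParameter α) {ℓ : ℝ≥0∞} (hℓ : ℓ ≠ ⊤) (hε : 0 < ε) {κ : ℝ}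
    (hκ0 : 0 < κ) (hκ1 : κ ≤ 1) {x : Fin K → 𝒳} (hx : ∀ j, x j ∈ A → ℓ ≤ I (x j)) :
    insEstimator I A α ε x ^ 2 ≤
      ((K.factorial : ℝ≥0∞) ^ 2 *
        expNeg (ENNReal.ofReal (V α) * ℓ / ENNReal.ofReal ε)) ^ κ *
      (expWeight I α ε x ^ κ)⁻¹ := by
  set C := (K.factorial : ℝ≥0∞) ^ 2 * expNeg (ENNReal.ofReal (V α) * ℓ / ENNReal.ofReal ε)
  have hC0 : C ≠ 0 := mul_ne_zero (by simp [Nat.factorial_ne_zero]) (expNeg_ne_zero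
    (ENNReal.div_ne_top (ENNReal.mul_ne_top ENNReal.ofReal_ne_top hℓ) (by simpa using hε)))
  have hCtop : C ≠ ⊤ :=
    ENNReal.mul_ne_top (ENNReal.pow_ne_top (ENNReal.natCast_ne_top _)) (expNeg_ne_top _)
  have hWtop : expWeight I α ε x ^ κ ≠ ⊤ :=
    ENNReal.rpow_ne_top_of_nonneg hκ0.le (expNeg_ne_top _)
  rw [← div_eq_mul_inv, ENNReal.le_div_iff_mul_le (Or.inr (by simp [hC0, hCtop])) (Or.inl hWtop)]
  calc insEstimator I A α ε x ^ 2 * expWeight I α ε x ^ κ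
      ≤ (insEstimator I A α ε x ^ 2) ^ κ * expWeight I α ε x ^ κ := by
        gcongr
        simpa only [ENNReal.rpow_one] using ENNReal.rpow_le_rpow_of_exponent_ge
          (pow_le_one₀ zero_le (insEstimator_le_one (I := I) (A := A) x)) hκ1
    _ = (insEstimator I A α ε x ^ 2 * expWeight I α ε x) ^ κ :=
        (ENNReal.mul_rpow_of_nonneg _ _ hκ0.le).symm
    _ ≤ C ^ κ := ENNReal.rpow_le_rpow (insEstimator_sq_mul_expWeight_le hα hx) hκ0.le

theorem le_insEstimator {x : Fin K → 𝒳} {σ : Equiv.Perm (Fin K)} (hx : x (σ 0) ∈ A)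
    {p q : ℝ≥0∞} (hp : p ≠ ⊤) (hε : 0 < ε)
    (hσ : ∑ j, (α j : ℝ≥0∞) * I (x (σ j)) ≤ p + q)
    (hτ : ∀ τ : Equiv.Perm (Fin K), p ≤ ∑ j, (α j : ℝ≥0∞) * I (x (τ j))) :
    (K.factorial : ℝ≥0∞)⁻¹ * expNeg (q / ENNReal.ofReal ε) ≤ insEstimator I A α ε x := by
  set P := expNeg (p / ENNReal.ofReal ε)
  have hP0 : P ≠ 0 := expNeg_ne_zero (ENNReal.div_ne_top hp (by simpa using hε))
  have hnum : P * expNeg (q / ENNReal.ofReal ε) ≤ expWeight I α ε (fun j => x (σ j)) := by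
    rw [← expNeg_add, ← ENNReal.add_div]
    exact expNeg_antitone (ENNReal.div_le_div_right hσ _)
  have hden : ∑ τ : Equiv.Perm (Fin K), expWeight I α ε (fun j => x (τ j)) ≤
      K.factorial * P := by
    simpa [Fintype.card_perm] using Finset.sum_le_card_nsmul Finset.univ
      (fun τ : Equiv.Perm (Fin K) => expWeight I α ε (fun j => x (τ j))) P
      fun τ _ => expNeg_antitone (ENNReal.div_le_div_right (hτ τ) _)
  calc (K.factorial : ℝ≥0∞)⁻¹ * expNeg (q / ENNReal.ofReal ε)
      = P * expNeg (q / ENNReal.ofReal ε) / (K.factorial * P) := by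
        rw [mul_comm (K.factorial : ℝ≥0∞), ENNReal.mul_div_mul_left _ _ hP0 (expNeg_ne_top _),
          mul_comm, ← div_eq_mul_inv]
    _ ≤ rho I α ε (fun j => x (σ j)) * A.indicator (fun _ => (1 : ℝ≥0∞)) (x (σ 0)) := by
        rw [indicator_of_mem hx, mul_one, rho_comp]
        exact ENNReal.div_le_div hnum hden
    _ ≤ insEstimator I A α ε x :=
        Finset.single_le_sum (f := fun σ : Equiv.Perm (Fin K) =>
          rho I α ε (fun j => x (σ j)) * A.indicator (fun _ => (1 : ℝ≥0∞)) (x (σ 0)))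
          (fun _ _ => zero_le) (Finset.mem_univ σ)

theorem le_insEstimator_of_mem_Icc (hα : Antitone α) (hε : 0 < ε) {ℓ u : Fin K → ℝ≥0}
    (hℓ : Monotone ℓ) {x : Fin K → 𝒳} (hx : ∀ j, I (x j) ∈ Icc (ℓ j : ℝ≥0∞) (u j))
    {σ : Equiv.Perm (Fin K)} (hσ : x (σ 0) ∈ A) {q : ℝ≥0}
    (hq : ∑ j, α j * u (σ j) ≤ ∑ j, α j * ℓ j + q) :
    (K.factorial : ℝ≥0∞)⁻¹ * expNeg (q / ENNReal.ofReal ε) ≤ insEstimator I A α ε x := by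
  refine le_insEstimator (p := ∑ j, (α j : ℝ≥0∞) * ℓ j) hσ
    (ENNReal.sum_ne_top.2 fun j _ => by finiteness) hε ?_ fun τ => ?_
  · calc ∑ j, (α j : ℝ≥0∞) * I (x (σ j)) ≤ ∑ j, (α j : ℝ≥0∞) * u (σ j) := by
          gcongr with j
          exact (hx _).2
      _ ≤ ∑ j, (α j : ℝ≥0∞) * ℓ j + q := by exact_mod_cast hq
  · calc ∑ j, (α j : ℝ≥0∞) * ℓ j ≤ ∑ j, (α j : ℝ≥0∞) * ℓ (τ j) := by
          exact_mod_cast sum_mul_le_sum_mul_of_monotone_comp hα (τ := 1) hℓ τ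
      _ ≤ ∑ j, (α j : ℝ≥0∞) * I (x (τ j)) := by
          gcongr with j
          exact (hx _).1

theorem measurable_insEstimator [MeasurableSpace 𝒳] (hI : Measurable I) (hA : MeasurableSet A) :
    Measurable (insEstimator I A α ε) := by
  have hperm (σ : Equiv.Perm (Fin K)) : Measurable fun (x : Fin K → 𝒳) j => x (σ j) :=
    measurable_pi_lambda _ fun j => measurable_pi_apply _
  have hweight : Measurable (expWeight I α ε) :=
    measurable_expNeg.comp ((Finset.measurable_sum _ fun j _ =>
      (hI.comp (measurable_pi_apply j)).const_mul _).div_const _)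
  have hrho : Measurable (rho I α ε) :=
    hweight.div (Finset.measurable_sum _ fun τ _ => hweight.comp (hperm τ))
  exact Finset.measurable_sum _ fun σ _ => (hrho.comp (hperm σ)).mul
    ((measurable_const.indicator hA).comp (measurable_pi_apply (σ 0)))

end Estimator

section SecondMoment

theorem lintegral_pi_prod {ι : Type*} [Fintype ι] {X : ι → Type*} [∀ i, MeasurableSpace (X i)]
    (ν : ∀ i, Measure (X i)) [∀ i, IsProbabilityMeasure (ν i)] {f : ∀ i, X i → ℝ≥0∞}
    (hf : ∀ i, Measurable (f i)) :
    ∫⁻ x, ∏ i, f i (x i) ∂(Measure.pi ν) = ∏ i, ∫⁻ x, f i x ∂(ν i) := by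
  rw [lintegral_prod_eq_prod_lintegral_of_indepFun _ (fun i (x : ∀ i, X i) => f i (x i))
    (iIndepFun_pi fun i => (hf i).aemeasurable) fun i => (hf i).comp (measurable_pi_apply i)]
  exact Finset.prod_congr rfl fun i _ => (measurePreserving_eval ν i).lintegral_comp (hf i)

variable {𝒳 : Type*} [MeasurableSpace 𝒳] {γ : Measure 𝒳} {I : 𝒳 → ℝ≥0∞} {A : Set 𝒳} {K : ℕ}
  {α : Fin K → ℝ≥0} {ε : ℝ}

/-- The joint law of `(X₁^ε, …, X_K^ε)`: independent coordinates, the `j`-th one distributed as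
`μ^{ε/αⱼ}`. -/
noncomputable def gibbsPi (γ : Measure 𝒳) (I : 𝒳 → ℝ≥0∞) (α : Fin K → ℝ≥0) (ε : ℝ) :
    Measure (Fin K → 𝒳) :=
  Measure.pi fun j => gibbs γ I (ENNReal.ofReal ε / α j)

theorem map_eq_gibbsPi {Ω : Type*} [MeasurableSpace Ω] {P : Measure Ω} [IsProbabilityMeasure P]
    {X : Fin K → Ω → 𝒳} (hind : iIndepFun X P)
    (hX : ∀ j, HasLaw (X j) (gibbs γ I (ENNReal.ofReal ε / α j)) P) :
    P.map (fun ω j => X j ω) = gibbsPi γ I α ε := by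
  rw [hind.map_fun_eq_pi_map fun j => (hX j).aemeasurable, gibbsPi]
  simp only [(hX _).map_eq]

theorem lintegral_expWeight_rpow_inv
    [∀ j, IsProbabilityMeasure (gibbs γ I (ENNReal.ofReal ε / α j))]
    (hI : Measurable I) (hε : 0 < ε) {η : ℝ} (hη0 : 0 < η) (hη1 : η ≤ 1) :
    ∫⁻ x, (expWeight I α ε x ^ (1 - η))⁻¹ ∂gibbsPi γ I α ε =
      ∏ j, (partitionFunction γ I (ENNReal.ofReal ε / α j))⁻¹ *
        partitionFunction γ I (ENNReal.ofReal ε / α j / ENNReal.ofReal η) := by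
  have hprod (x : Fin K → 𝒳) : (expWeight I α ε x ^ (1 - η))⁻¹ =
      ∏ j, expNeg (I (x j) / (ENNReal.ofReal ε / α j)) ^ (η - 1) := by
    rw [expWeight_eq_prod, ← ENNReal.prod_rpow_of_nonneg (sub_nonneg.2 hη1),
      ENNReal.prod_inv_distrib fun i _ j _ _ => Or.inr
        (ENNReal.rpow_ne_top_of_nonneg (sub_nonneg.2 hη1) (expNeg_ne_top _))]
    simp only [← ENNReal.rpow_neg, neg_sub, div_temperature hε]
  simp only [hprod, gibbsPi]
  rw [lintegral_pi_prod (fun j => gibbs γ I (ENNReal.ofReal ε / α j))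
    (f := fun j y => expNeg (I y / (ENNReal.ofReal ε / α j)) ^ (η - 1))
    fun j => (measurable_expNeg.comp (hI.div_const _)).pow_const _]
  simp only [lintegral_expNeg_rpow_gibbs hI _ hη0]

theorem ae_gibbsPi_of_le_essInf [∀ j, IsProbabilityMeasure (gibbs γ I (ENNReal.ofReal ε / α j))]
    (hA : MeasurableSet A) {ℓ : ℝ≥0∞} (hℓ : ℓ ≤ essInf I (γ.restrict A)) :
    ∀ᵐ x ∂gibbsPi γ I α ε, ∀ j, x j ∈ A → ℓ ≤ I (x j) := by
  have hae : ∀ᵐ y ∂γ, y ∈ A → ℓ ≤ I y := (ae_restrict_iff' hA).1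
    ((ae_essInf_le (f := I) (μ := γ.restrict A)).mono fun y hy => hℓ.trans hy)
  exact eventually_all.2 fun j => (Measure.tendsto_eval_ae_ae
    (μ := fun j => gibbs γ I (ENNReal.ofReal ε / α j))).eventually
    ((gibbs_absolutelyContinuous γ I _).ae_le hae)

theorem mul_expNeg_div_rpow_one_sub_le {C t : ℝ≥0∞} (hC : 1 ≤ C) (ht : t ≠ ⊤) (hε0 : 0 < ε)
    (hε1 : ε ≤ 1) :
    (C * expNeg (t / ENNReal.ofReal ε)) ^ (1 - ε) ≤
      C * (expNeg t)⁻¹ * expNeg (t / ENNReal.ofReal ε) := by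
  have hκ : 0 ≤ 1 - ε := sub_nonneg.2 hε1
  have hsplit : expNeg t * expNeg (t / ENNReal.ofReal ε) ^ (1 - ε) =
      expNeg (t / ENNReal.ofReal ε) := by
    have ht_eq : ENNReal.ofReal ε * (t / ENNReal.ofReal ε) = t :=
      ENNReal.mul_div_cancel (by simpa using hε0) ENNReal.ofReal_ne_top
    rw [expNeg_rpow hκ, ← expNeg_add]
    nth_rw 1 [← ht_eq]
    rw [← add_mul, ← ENNReal.ofReal_add hε0.le hκ, add_sub_cancel, ENNReal.ofReal_one, one_mul]
  calc (C * expNeg (t / ENNReal.ofReal ε)) ^ (1 - ε)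
      = C ^ (1 - ε) * expNeg (t / ENNReal.ofReal ε) ^ (1 - ε) := ENNReal.mul_rpow_of_nonneg _ _ hκ
    _ ≤ C * expNeg (t / ENNReal.ofReal ε) ^ (1 - ε) := by
        gcongr
        exact (ENNReal.rpow_le_rpow_of_exponent_le hC (by linarith)).trans_eq (ENNReal.rpow_one C)
    _ = C * (expNeg t)⁻¹ * expNeg (t / ENNReal.ofReal ε) := by
        rw [mul_assoc, ← ENNReal.div_eq_inv_mul,
          (ENNReal.eq_div_iff (expNeg_ne_zero ht) (expNeg_ne_top t)).2 hsplit]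

theorem prod_inv_partitionFunction_le (hI : Measurable I) (hε : 0 < ε) (d : ℝ≥0) :
    ∏ j, (partitionFunction γ I (ENNReal.ofReal ε / α j))⁻¹ ≤
      (∏ _j : Fin K, (γ {x | I x ≤ d})⁻¹) *
        (expNeg ((∑ j, (α j : ℝ≥0∞)) * d / ENNReal.ofReal ε))⁻¹ := by
  have htop (j) : (α j : ℝ≥0∞) * d / ENNReal.ofReal ε ≠ ⊤ :=
    ENNReal.div_ne_top (by finiteness) (by simpa using hε)
  rw [Finset.sum_mul, ENNReal.div_eq_inv_mul, Finset.mul_sum, expNeg_sum,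
    ENNReal.prod_inv_distrib fun i _ j _ _ => Or.inr (expNeg_ne_top _), ← Finset.prod_mul_distrib]
  refine Finset.prod_le_prod' fun j _ => ?_
  refine (ENNReal.inv_le_inv.2 (expNeg_mul_le_partitionFunction hI _ d)).trans_eq ?_
  rw [div_temperature hε, ENNReal.mul_inv (Or.inl (expNeg_ne_zero (htop j)))
    (Or.inl (expNeg_ne_top _)), mul_comm, ENNReal.div_eq_inv_mul]

theorem expNeg_add_div_mul_inv (p : ℝ≥0∞) {q : ℝ≥0∞} (hq : q ≠ ⊤) (hε : 0 < ε) :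
    expNeg ((p + q) / ENNReal.ofReal ε) * (expNeg (q / ENNReal.ofReal ε))⁻¹ =
      expNeg (p / ENNReal.ofReal ε) := by
  rw [ENNReal.add_div, expNeg_add, mul_assoc, ENNReal.mul_inv_cancel _ (expNeg_ne_top _), mul_one]
  exact expNeg_ne_zero (ENNReal.div_ne_top hq (by simpa using hε))

theorem mul_expNeg_le_gibbsPi [∀ j, IsProbabilityMeasure (gibbs γ I (ENNReal.ofReal ε / α j))]
    (hε : 0 < ε) {η : ℝ} (hη : ε ≤ η) {B : Fin K → Set 𝒳} (hB : ∀ j, MeasurableSet (B j))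
    {u : Fin K → ℝ≥0∞} (hu : ∀ j, ∀ y ∈ B j, I y ≤ u j) :
    (∏ j, (partitionFunction γ I (ENNReal.ofReal η / α j))⁻¹ * γ (B j)) *
        expNeg ((∑ j, (α j : ℝ≥0∞) * u j) / ENNReal.ofReal ε) ≤
      gibbsPi γ I α ε (univ.pi B) := by
  rw [gibbsPi, Measure.pi_pi, ENNReal.div_eq_inv_mul, Finset.mul_sum, expNeg_sum,
    ← Finset.prod_mul_distrib]
  refine Finset.prod_le_prod' fun j _ => le_trans (le_of_eq ?_) (inv_mul_expNeg_le_gibbs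
    (ENNReal.div_le_div_right (ENNReal.ofReal_le_ofReal hη) _) (hB j) (hu j))
  rw [div_temperature hε, ENNReal.div_eq_inv_mul (a := _ * _), mul_assoc, mul_comm (γ _)]

theorem exists_pos_mul_add_eq {p r s : ℝ≥0} (hp : p < r) (hs : 0 < s) :
    ∃ d : ℝ≥0, 0 < d ∧ p + s * d = r :=
  ⟨(r - p) / s, div_pos (tsub_pos_of_lt hp) hs, by
    rw [mul_div_cancel₀ _ hs.ne', add_tsub_cancel_of_le hp.le]⟩

theorem exists_measurableSet_stepLevel (hI : Measurable I) (hI0 : essInf I γ = 0)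
    (hA : MeasurableSet A) {a d : ℝ≥0} (ha : essInf I (γ.restrict A) = a) (hd : 0 < d)
    (k : Fin K) :
    ∃ B : Fin K → Set 𝒳, (∀ j, MeasurableSet (B j)) ∧ (∀ j, γ (B j) ≠ 0) ∧
      (∀ j, ∀ y ∈ B j, I y ∈ Icc (stepLevel k a j : ℝ≥0∞) (stepLevel k a j + d : ℝ≥0)) ∧
      ∀ j, k ≤ j → B j ⊆ A := by
  have hj (j : Fin K) : ∃ S : Set 𝒳, MeasurableSet S ∧ γ S ≠ 0 ∧
      (∀ y ∈ S, I y ∈ Icc (stepLevel k a j : ℝ≥0∞) (stepLevel k a j + d : ℝ≥0)) ∧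
      (k ≤ j → S ⊆ A) := by
    by_cases hkj : k ≤ j
    · have hlt : essInf I (γ.restrict A) < (a + d : ℝ≥0) := by
        rw [ha, ENNReal.coe_lt_coe]
        exact lt_add_of_pos_right a hd
      refine ⟨I ⁻¹' Icc a (a + d : ℝ≥0) ∩ A, (hI measurableSet_Icc).inter hA, ?_, ?_,
        fun _ => inter_subset_right⟩
      · rw [← Measure.restrict_apply (hI measurableSet_Icc), ← ha]
        exact measure_preimage_Icc_essInf_ne_zero hlt
      · simp only [stepLevel, if_pos hkj]
        exact fun y hy => hy.1
    · have hlt : essInf I γ < d := by simpa [hI0] using hd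
      refine ⟨I ⁻¹' Icc (essInf I γ) d, hI measurableSet_Icc,
        measure_preimage_Icc_essInf_ne_zero hlt, ?_, fun h => absurd h hkj⟩
      simp only [stepLevel, if_neg hkj, hI0, zero_add]
      exact fun y hy => hy
  choose B hB using hj
  exact ⟨B, fun j => (hB j).1, fun j => (hB j).2.1, fun j => (hB j).2.2.1, fun j => (hB j).2.2.2⟩

variable [NeZero K]

theorem lintegral_insEstimator_sq_le
    [∀ j, IsProbabilityMeasure (gibbs γ I (ENNReal.ofReal ε / α j))] (hI : Measurable I)
    (hA : MeasurableSet A) (hα : IsParameter α) (hε0 : 0 < ε) (hε1 : ε < 1) {ℓ r d : ℝ≥0}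
    (hℓ : ℓ ≤ essInf I (γ.restrict A))
    (hr : ENNReal.ofReal (V α) * ℓ = r + (∑ j, (α j : ℝ≥0∞)) * d) :
    ∫⁻ x, insEstimator I A α ε x ^ 2 ∂gibbsPi γ I α ε ≤
      (K.factorial : ℝ≥0∞) ^ 2 * (expNeg (ENNReal.ofReal (V α) * ℓ))⁻¹ *
        ((∏ _j : Fin K, (γ {x | I x ≤ d})⁻¹) *
          ∏ j, partitionFunction γ I (ENNReal.ofReal 1 / α j)) *
        expNeg (r / ENNReal.ofReal ε) := by
  set C := (K.factorial : ℝ≥0∞) ^ 2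
  set t := ENNReal.ofReal (V α) * ℓ
  set s := ∑ j, (α j : ℝ≥0∞)
  set G := ∏ _j : Fin K, (γ {x | I x ≤ d})⁻¹
  set Z := ∏ j, partitionFunction γ I (ENNReal.ofReal 1 / α j)
  have hκ : (C * expNeg (t / ENNReal.ofReal ε)) ^ (1 - ε) ≠ ⊤ :=
    ENNReal.rpow_ne_top_of_nonneg (by linarith) (ENNReal.mul_ne_top (by finiteness)
      (expNeg_ne_top _))
  have hC : 1 ≤ C := one_le_pow₀ (by exact_mod_cast K.factorial_pos)
  have ht : t ≠ ⊤ := by finiteness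
  have hs : s ≠ ⊤ := ENNReal.sum_ne_top.2 fun _ _ => ENNReal.coe_ne_top
  calc ∫⁻ x, insEstimator I A α ε x ^ 2 ∂gibbsPi γ I α ε
      ≤ ∫⁻ x, (C * expNeg (t / ENNReal.ofReal ε)) ^ (1 - ε) *
          (expWeight I α ε x ^ (1 - ε))⁻¹ ∂gibbsPi γ I α ε := by
        refine lintegral_mono_ae ?_
        filter_upwards [ae_gibbsPi_of_le_essInf hA hℓ] with x hx
        exact insEstimator_sq_le hα ENNReal.coe_ne_top hε0 (sub_pos.2 hε1) (by linarith) hx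
    _ = (C * expNeg (t / ENNReal.ofReal ε)) ^ (1 - ε) *
          ((∏ j, (partitionFunction γ I (ENNReal.ofReal ε / α j))⁻¹) * Z) := by
        rw [lintegral_const_mul' _ _ hκ,
          lintegral_expWeight_rpow_inv hI hε0 hε0 hε1.le, Finset.prod_mul_distrib]
        simp only [ofReal_div_div_ofReal hε0, Z]
    _ ≤ C * (expNeg t)⁻¹ * expNeg (t / ENNReal.ofReal ε) *
          (G * (expNeg (s * d / ENNReal.ofReal ε))⁻¹ * Z) := by
        gcongr
        · exact mul_expNeg_div_rpow_one_sub_le hC ht hε0 hε1.le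
        · exact prod_inv_partitionFunction_le hI hε0 d
    _ = C * (expNeg t)⁻¹ * (G * Z) *
          (expNeg (t / ENNReal.ofReal ε) * (expNeg (s * d / ENNReal.ofReal ε))⁻¹) := by ring
    _ = C * (expNeg t)⁻¹ * (G * Z) * expNeg (r / ENNReal.ofReal ε) := by
        rw [hr, expNeg_add_div_mul_inv _ (ENNReal.mul_ne_top hs ENNReal.coe_ne_top) hε0]

theorem sum_pos_of_isParameter (hα : IsParameter α) : 0 < ∑ j, α j :=
  Finset.sum_pos' (fun _ _ => zero_le) ⟨0, Finset.mem_univ _, by simp [hα.1]⟩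

theorem exists_lintegral_insEstimator_sq_le (hI : Measurable I) (hI0 : essInf I γ = 0)
    (hA : MeasurableSet A) (hα : IsParameter α)
    (hν : ∀ ε : ℝ, 0 < ε → ∀ j, IsProbabilityMeasure (gibbs γ I (ENNReal.ofReal ε / α j)))
    {r : ℝ≥0} (hr : r < ENNReal.ofReal (V α) * essInf I (γ.restrict A)) :
    ∃ c : ℝ≥0∞, c ≠ ⊤ ∧ ∀ᶠ ε in 𝓝[>] 0,
      ∫⁻ x, insEstimator I A α ε x ^ 2 ∂gibbsPi γ I α ε ≤ c * expNeg (r / ENNReal.ofReal ε) := by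
  have hV : 0 < (V α).toNNReal := Real.toNNReal_pos.2 (zero_lt_one.trans_le (one_le_V hα))
  obtain ⟨ℓ, hrℓ, hℓ⟩ : ∃ ℓ : ℝ≥0, r < (V α).toNNReal * ℓ ∧ ℓ ≤ essInf I (γ.restrict A) := by
    obtain ⟨ℓ, hrℓ, hℓ⟩ := ENNReal.lt_iff_exists_nnreal_btwn.1 (ENNReal.div_lt_of_lt_mul' hr)
    refine ⟨ℓ, ?_, hℓ.le⟩
    rw [ENNReal.ofReal, ← ENNReal.coe_div hV.ne', ENNReal.coe_lt_coe] at hrℓ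
    exact (div_lt_iff₀' hV).1 hrℓ
  obtain ⟨d, hd0, hd⟩ := exists_pos_mul_add_eq hrℓ (sum_pos_of_isParameter hα)
  have hr_eq : ENNReal.ofReal (V α) * ℓ = r + (∑ j, (α j : ℝ≥0∞)) * d := by
    rw [ENNReal.ofReal]
    exact_mod_cast hd.symm
  have hγ : γ {x | I x ≤ d} ≠ 0 := by
    have h := measure_preimage_Icc_essInf_ne_zero (f := I) (ν := γ) (b := d) (by simpa [hI0])
    exact fun h0 => h (measure_mono_null (fun x hx => hx.2) h0)
  refine ⟨(K.factorial : ℝ≥0∞) ^ 2 * (expNeg (ENNReal.ofReal (V α) * ℓ))⁻¹ *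
    ((∏ _j : Fin K, (γ {x | I x ≤ d})⁻¹) *
      ∏ j, partitionFunction γ I (ENNReal.ofReal 1 / α j)), ?_, ?_⟩
  · have := hν 1 zero_lt_one
    refine ENNReal.mul_ne_top (ENNReal.mul_ne_top (by finiteness) ?_) (ENNReal.mul_ne_top ?_ ?_)
    · exact ENNReal.inv_ne_top.2 (expNeg_ne_zero (by finiteness))
    · exact ENNReal.prod_ne_top fun j _ => ENNReal.inv_ne_top.2 hγ
    · exact ENNReal.prod_ne_top fun j _ => partitionFunction_ne_zero_and_ne_top.2
  · filter_upwards [Ioo_mem_nhdsGT zero_lt_one] with ε hε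
    have := hν ε hε.1
    exact lintegral_insEstimator_sq_le hI hA hα hε.1 hε.2 hℓ hr_eq

theorem le_lintegral_insEstimator_sq
    [∀ j, IsProbabilityMeasure (gibbs γ I (ENNReal.ofReal ε / α j))] (hα : Antitone α)
    (hε : 0 < ε) {η : ℝ} (hη : ε ≤ η) {B : Fin K → Set 𝒳} (hB : ∀ j, MeasurableSet (B j))
    {ℓ u : Fin K → ℝ≥0} (hℓ : Monotone ℓ) (hBI : ∀ j, ∀ y ∈ B j, I y ∈ Icc (ℓ j : ℝ≥0∞) (u j))
    {σ : Equiv.Perm (Fin K)} (hσ : B (σ 0) ⊆ A) {q r : ℝ≥0}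
    (hq : ∑ j, α j * u (σ j) ≤ ∑ j, α j * ℓ j + q) (hr : 2 * q + ∑ j, α j * u j = r) :
    ((K.factorial : ℝ≥0∞)⁻¹ ^ 2 *
        ∏ j, (partitionFunction γ I (ENNReal.ofReal η / α j))⁻¹ * γ (B j)) *
        expNeg (r / ENNReal.ofReal ε) ≤
      ∫⁻ x, insEstimator I A α ε x ^ 2 ∂gibbsPi γ I α ε := by
  set D := ∏ j, (partitionFunction γ I (ENNReal.ofReal η / α j))⁻¹ * γ (B j)
  set m := (K.factorial : ℝ≥0∞)⁻¹ * expNeg (q / ENNReal.ofReal ε) with hm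
  have hr_cast : (r : ℝ≥0∞) = q + q + ∑ j, (α j : ℝ≥0∞) * u j := by
    rw [← two_mul]
    exact_mod_cast hr.symm
  calc ((K.factorial : ℝ≥0∞)⁻¹ ^ 2 * D) * expNeg (r / ENNReal.ofReal ε)
      = m ^ 2 * (D * expNeg ((∑ j, (α j : ℝ≥0∞) * u j) / ENNReal.ofReal ε)) := by
        rw [hr_cast, ENNReal.add_div, ENNReal.add_div, expNeg_add, expNeg_add, hm]
        ring
    _ ≤ m ^ 2 * gibbsPi γ I α ε (univ.pi B) := by
        gcongr
        exact mul_expNeg_le_gibbsPi hε hη hB fun j y hy => (hBI j y hy).2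
    _ = ∫⁻ _ in univ.pi B, m ^ 2 ∂gibbsPi γ I α ε := (setLIntegral_const _ _).symm
    _ ≤ ∫⁻ x in univ.pi B, insEstimator I A α ε x ^ 2 ∂gibbsPi γ I α ε := by
        refine setLIntegral_mono' (MeasurableSet.univ_pi hB) fun x hx => ?_
        gcongr
        exact le_insEstimator_of_mem_Icc hα hε hℓ (fun j => hBI j _ (hx j (mem_univ _)))
          (hσ (hx _ (mem_univ _))) hq
    _ ≤ ∫⁻ x, insEstimator I A α ε x ^ 2 ∂gibbsPi γ I α ε := setLIntegral_le_lintegral _ _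

theorem exists_le_lintegral_insEstimator_sq (hI : Measurable I) (hI0 : essInf I γ = 0)
    (hA : MeasurableSet A) (hα : IsParameter α)
    (hν : ∀ ε : ℝ, 0 < ε → ∀ j, IsProbabilityMeasure (gibbs γ I (ENNReal.ofReal ε / α j)))
    {r : ℝ≥0} (hr : ENNReal.ofReal (V α) * essInf I (γ.restrict A) < r) :
    ∃ c : ℝ≥0∞, c ≠ 0 ∧ ∀ᶠ ε in 𝓝[>] 0,
      c * expNeg (r / ENNReal.ofReal ε) ≤ ∫⁻ x, insEstimator I A α ε x ^ 2 ∂gibbsPi γ I α ε := by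
  obtain ⟨n, rfl⟩ := Nat.exists_eq_add_one_of_ne_zero (NeZero.ne K)
  obtain ⟨k, hk⟩ := exists_V_eq_tailDecay hα
  have hessInf : essInf I (γ.restrict A) ≠ ⊤ := fun htop => hr.not_ge <| by
    simp [htop, ENNReal.mul_top, (zero_lt_one.trans_le (one_le_V hα)).not_ge]
  obtain ⟨a, ha⟩ : ∃ a : ℝ≥0, (a : ℝ≥0∞) = essInf I (γ.restrict A) :=
    ⟨_, ENNReal.coe_toNNReal hessInf⟩
  obtain ⟨d, hd0, hd⟩ : ∃ d : ℝ≥0, 0 < d ∧ (V α).toNNReal * a + 3 * (∑ j, α j) * d = r := by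
    refine exists_pos_mul_add_eq ?_ (mul_pos three_pos (sum_pos_of_isParameter hα))
    rw [← ha, ENNReal.ofReal] at hr
    exact_mod_cast hr
  obtain ⟨B, hB, hB0, hBI, hBA⟩ := exists_measurableSet_stepLevel hI hI0 hA ha.symm hd0 k
  set σ := (finRotate (n + 1)).symm
  have hσ : σ 0 = Fin.last n := (Equiv.symm_apply_eq _).2 finRotate_last.symm
  have hαk : α k ≤ 1 := hα.1 ▸ hα.2 (Fin.zero_le k)
  set q : ℝ≥0 := (1 - α k) * a + (∑ j, α j) * d
  have hq : ∑ j, α j * (stepLevel k a (σ j) + d) ≤ ∑ j, α j * stepLevel k a j + q := by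
    simp only [mul_add, Finset.sum_add_distrib, ← Finset.sum_mul]
    rw [sum_mul_stepLevel_finRotate_symm hα.1 hαk, add_assoc]
  have hr_eq : 2 * q + ∑ j, α j * (stepLevel k a j + d) = r := by
    have hVa : (V α).toNNReal * a = 2 * ((1 - α k) * a) + ∑ j, α j * stepLevel k a j := by
      rw [← NNReal.coe_inj, coe_two_mul_add_sum_mul_stepLevel hαk, NNReal.coe_mul,
        Real.coe_toNNReal _ (zero_le_one.trans (one_le_V hα)), hk]
    rw [← hd, hVa]
    simp only [q, mul_add, Finset.sum_add_distrib, ← Finset.sum_mul]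
    ring
  refine ⟨((n + 1).factorial : ℝ≥0∞)⁻¹ ^ 2 *
    ∏ j, (partitionFunction γ I (ENNReal.ofReal 1 / α j))⁻¹ * γ (B j), ?_, ?_⟩
  · have := hν 1 zero_lt_one
    refine mul_ne_zero (pow_ne_zero _ (ENNReal.inv_ne_zero.2 (ENNReal.natCast_ne_top _)))
      (Finset.prod_ne_zero_iff.2 fun j _ => mul_ne_zero ?_ (hB0 j))
    exact ENNReal.inv_ne_zero.2 partitionFunction_ne_zero_and_ne_top.2
  · filter_upwards [Ioo_mem_nhdsGT zero_lt_one] with ε hε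
    have := hν ε hε.1
    exact le_lintegral_insEstimator_sq hα.2 hε.1 hε.2.le hB (monotone_stepLevel k a) hBI
      (hBA _ (hσ ▸ Fin.le_last k)) hq hr_eq

theorem tendsto_neg_mul_log_lintegral_insEstimator_sq (hI : Measurable I) (hI0 : essInf I γ = 0)
    (hA : MeasurableSet A) (hα : IsParameter α)
    (hν : ∀ ε : ℝ, 0 < ε → ∀ j, IsProbabilityMeasure (gibbs γ I (ENNReal.ofReal ε / α j))) :
    Tendsto (fun ε : ℝ => -((ε : EReal) * ENNReal.log
        (∫⁻ x, insEstimator I A α ε x ^ 2 ∂gibbsPi γ I α ε)))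
      (𝓝[>] 0) (𝓝 ((V α : EReal) * ((essInf I (γ.restrict A) : ℝ≥0∞) : EReal))) := by
  have hV : (V α : EReal) * ((essInf I (γ.restrict A) : ℝ≥0∞) : EReal) =
      ((ENNReal.ofReal (V α) * essInf I (γ.restrict A) : ℝ≥0∞) : EReal) := by
    rw [EReal.coe_ennreal_mul, EReal.coe_ennreal_ofReal,
      max_eq_left (zero_le_one.trans (one_le_V hα))]
  rw [hV]
  refine tendsto_neg_mul_log ?_ (fun r => exists_lintegral_insEstimator_sq_le hI hI0 hA hα hν)
    (fun r => exists_le_lintegral_insEstimator_sq hI hI0 hA hα hν)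
  filter_upwards [self_mem_nhdsWithin] with ε hε
  have := hν ε hε
  have : IsProbabilityMeasure (gibbsPi γ I α ε) := by unfold gibbsPi; infer_instance
  calc ∫⁻ x, insEstimator I A α ε x ^ 2 ∂gibbsPi γ I α ε
      ≤ ∫⁻ _, 1 ∂gibbsPi γ I α ε :=
        lintegral_mono fun x => pow_le_one₀ zero_le (insEstimator_le_one x)
    _ = 1 := by simp

end SecondMoment

end INS

theorem theorem2_general {𝒳 : Type*} [MeasurableSpace 𝒳] (γ : Measure 𝒳) (I : 𝒳 → ℝ≥0∞)
    (hI : Measurable I) (hI0 : essInf I γ = 0) (A : Set 𝒳) (hA : MeasurableSet A)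
    (K : ℕ) [NeZero K] :
    (∀ α : Fin K → ℝ≥0, INS.IsParameter α →
      ∀ (Ω : ℝ → Type*) [∀ ε, MeasurableSpace (Ω ε)] (P : ∀ ε, Measure (Ω ε))
        [∀ ε, IsProbabilityMeasure (P ε)] (X : ∀ ε, Fin K → Ω ε → 𝒳),
        (∀ ε, 0 < ε → iIndepFun (X ε) (P ε)) →
        (∀ ε, 0 < ε → ∀ j,
          HasLaw (X ε j) (INS.gibbs γ I (ENNReal.ofReal ε / (α j : ℝ≥0∞))) (P ε)) →
        Tendsto
          (fun ε : ℝ => -((ε : EReal) * ENNReal.log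
            (∫⁻ ω, (INS.insEstimator I A α ε (fun j => X ε j ω)) ^ 2 ∂(P ε))))
          (𝓝[>] (0 : ℝ))
          (𝓝 ((INS.V α : EReal) * ((essInf I (γ.restrict A) : ℝ≥0∞) : EReal)))) ∧
    INS.IsParameter (INS.alphaStar K) ∧
    INS.V (INS.alphaStar K) = 2 - (1 / 2 : ℝ) ^ (K - 1) ∧
    ∀ α : Fin K → ℝ≥0, INS.IsParameter α → INS.V α ≤ INS.V (INS.alphaStar K) := by
  refine ⟨fun α hα Ω _ P _ X hind hX => ?_, INS.isParameter_alphaStar K, INS.V_alphaStar K,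
    fun α hα => (INS.V_le_of_isParameter hα).trans_eq (INS.V_alphaStar K).symm⟩
  have hν (ε : ℝ) (hε : 0 < ε) (j : Fin K) :
      IsProbabilityMeasure (INS.gibbs γ I (ENNReal.ofReal ε / α j)) :=
    (hX ε hε j).isProbabilityMeasure_iff.1 inferInstance
  refine (INS.tendsto_neg_mul_log_lintegral_insEstimator_sq hI hI0 hA hα hν).congr' ?_
  filter_upwards [self_mem_nhdsWithin] with ε hε
  rw [← INS.map_eq_gibbsPi (hind ε hε) (hX ε hε),
    lintegral_map' ((INS.measurable_insEstimator hI hA).pow_const 2).aemeasurable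
      (aemeasurable_pi_lambda _ fun j => (hX ε hε j).aemeasurable)]

theorem theorem2 {𝒳 : Type*} [TopologicalSpace 𝒳] [PolishSpace 𝒳] [MeasurableSpace 𝒳]
    [BorelSpace 𝒳] (μ : ℝ → Measure 𝒳) (γ : Measure 𝒳) (I : 𝒳 → ℝ≥0∞)
    (hμ : INS.IsGibbsFamily μ γ I)
    (hI : ContinuousOn I {x | I x < ∞})
    (A : Set 𝒳) (hA : A = closure (interior A))
    (hAI : (Subtype.val ⁻¹' A : Set {x : 𝒳 // I x < ∞}) =
      closure (interior (Subtype.val ⁻¹' A : Set {x : 𝒳 // I x < ∞})))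
    (K : ℕ) [NeZero K] :
    (∀ α : Fin K → ℝ≥0, INS.IsParameter α →
      ∀ (Ω : ℝ → Type*) [∀ ε, MeasurableSpace (Ω ε)] (P : ∀ ε, Measure (Ω ε))
        [∀ ε, IsProbabilityMeasure (P ε)] (X : ∀ ε, Fin K → Ω ε → 𝒳),
        (∀ ε, 0 < ε → iIndepFun (X ε) (P ε)) →
        (∀ ε, 0 < ε → ∀ j,
          HasLaw (X ε j) (INS.gibbs γ I (ENNReal.ofReal ε / (α j : ℝ≥0∞))) (P ε)) →
        Tendsto
          (fun ε : ℝ => -((ε : EReal) * ENNReal.log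
            (∫⁻ ω, (INS.insEstimator I A α ε (fun j => X ε j ω)) ^ 2 ∂(P ε))))
          (𝓝[>] (0 : ℝ))
          (𝓝 ((INS.V α : EReal) * (INS.infOver I A : EReal)))) ∧
    INS.IsParameter (INS.alphaStar K) ∧
    INS.V (INS.alphaStar K) = 2 - (1 / 2 : ℝ) ^ (K - 1) ∧
    ∀ α : Fin K → ℝ≥0, INS.IsParameter α → INS.V α ≤ INS.V (INS.alphaStar K) := by
  have hAm : MeasurableSet A := hA ▸ isClosed_closure.measurableSet
  rw [← hμ.essInf_restrict_eq_infOver hI hAm hAI.subset]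
  exact theorem2_general γ I hμ.ldp.isRateFunction.measurable (hμ.essInf_eq_zero hI) A hAm K
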